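/- Let $n\ge 2$, $N=n^2$, and let the $N$ vertices $|x,y\rangle$, $x,y\in\mathbb Z/n\mathbb Z$, form the $\sqrt N\times\sqrt N$ grid with periodic boundary conditions. Let $|\Uparrow\rangle=|0\rangle$, $|\Downarrow\rangle=|1\rangle$ be the standard basis of the coin space $\mathbb C^2$, let $|\Leftarrow\rangle=\frac1{\sqrt2}(|0\rangle+|1\rangle)$, $|\Rightarrow\rangle=\frac1{\sqrt2}(|0\rangle-|1\rangle)$ be its Hadamard basis, and $|s\rangle=\frac1{\sqrt2}(|\Uparrow\rangle+|\Downarrow\rangle)$. Let $U$ be the unitary on $\mathbb C^2\otimes\mathbb C^N$ that first moves up/down, $|\Uparrow\rangle|x,y\rangle\mapsto|\Uparrow\rangle|x,y-1\rangle$, $|\Downarrow\rangle|x,y\rangle\mapsto|\Downarrow\rangle|x,y+1\rangle$, and then moves left/right, $|\Leftarrow\rangle|x,y\rangle\mapsto|\Leftarrow\rangle|x-1,y\rangle$, $|\Rightarrow\rangle|x,y\rangle\mapsto|\Rightarrow\rangle|x+1,y\rangle$. For a marked vertex $v$ let $U'_v=U(I-2|s,v\rangle\langle s,v|)$. (a)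 There are absolute constants $C,c>0$ such that for every $n\ge2$ there is a $T\le C\sqrt{N\log N}$ such that for every marked vertex $v$, applying $U'_v$ to the uniform superposition $\frac1{\sqrt{2N}}\sum_{i,x,y}|i\rangle|x,y\rangle$ $T$ times and then measuring the vertex register gives $v$ with probability at least $c/\log N$. (b) A local search algorithm with internal space $\mathbb C^2$ is a finite sequence of steps, applied in order to a fixed starting state in $\mathbb C^2\otimes\mathbb C^N$. Each step is either a query, given by two unitaries $Q_0,Q_1$ of $\mathbb C^2$, where $Q_1$ is applied to the internal register at the marked vertex and $Q_0$ at the other vertices; or a local transformation, a unitary that does not depend on the marked vertex and maps every state located at a vertex to a state supported on this vertex and its neighbours in the grid. There are absolute constants $C,c>0$ such that for every $n\ge2$ there is a local search algorithm with starting state $|\Uparrow\rangle|0,0\rangle$ and at most $C\sqrt N\log N$ steps such that, for every marked vertex $v$, measuring the vertex register of its final state gives $v$ with probability at least $c$. -/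

import Mathlib

open scoped Matrix Kronecker

namespace GridSearch

/-- The vertices of the `n × n` grid with periodic boundary conditions, as pairs `(x, y)`. -/
abbrev Grid (n : ℕ) : Type := ZMod n × ZMod n

/-- The grid as an undirected graph: two distinct vertices are adjacent when they differ by
one step in the horizontal or in the vertical direction. -/
def gridGraph (n : ℕ) : SimpleGraph (Grid n) :=
  SimpleGraph.circulantGraph {((1 : ZMod n), (0 : ZMod n)), ((0 : ZMod n), (1 : ZMod n))}

/-! ### Measurement -/

/-- The probability that measuring the vertex register of the state `ψ` gives `v`. -/
noncomputable def probAt {ι V : Type*} [Fintype ι] (ψ : ι × V → ℂ) (v : V) : ℝ :=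
  ∑ i, ‖ψ (i, v)‖ ^ 2

/-! ### The quantum walk with a two-dimensional coin -/

/-- The coin state `⇑`. -/
def ketUp : Fin 2 → ℂ := ![1, 0]

/-- The coin state `⇓`. -/
def ketDown : Fin 2 → ℂ := ![0, 1]

/-- The coin state `⇐ = (⇑ + ⇓) / √2`. -/
noncomputable def ketLeft : Fin 2 → ℂ := ((√2 : ℝ) : ℂ)⁻¹ • (ketUp + ketDown)

/-- The coin state `⇒ = (⇑ - ⇓) / √2`. -/
noncomputable def ketRight : Fin 2 → ℂ := ((√2 : ℝ) : ℂ)⁻¹ • (ketUp - ketDown)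

/-- The uniform coin state `s = (⇑ + ⇓) / √2`. -/
noncomputable def ketS : Fin 2 → ℂ := ((√2 : ℝ) : ℂ)⁻¹ • (ketUp + ketDown)

/-- The rank one operator `|a⟩⟨a|`. -/
noncomputable def ketbra {m : Type*} (a : m → ℂ) : Matrix m m ℂ := Matrix.vecMulVec a (star a)

/-- The translation `|v⟩ ↦ |v + g⟩` of the vertex register. -/
def shift (n : ℕ) (g : Grid n) : Matrix (Grid n) (Grid n) ℂ :=
  Matrix.of fun w v => if w = v + g then 1 else 0

/-- Move up/down: `|⇑⟩|x, y⟩ ↦ |⇑⟩|x, y - 1⟩` and `|⇓⟩|x, y⟩ ↦ |⇓⟩|x, y + 1⟩`. -/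
noncomputable def moveUpDown (n : ℕ) : Matrix (Fin 2 × Grid n) (Fin 2 × Grid n) ℂ :=
  ketbra ketUp ⊗ₖ shift n (0, -1) + ketbra ketDown ⊗ₖ shift n (0, 1)

/-- Move left/right: `|⇐⟩|x, y⟩ ↦ |⇐⟩|x - 1, y⟩` and `|⇒⟩|x, y⟩ ↦ |⇒⟩|x + 1, y⟩`. -/
noncomputable def moveLeftRight (n : ℕ) : Matrix (Fin 2 × Grid n) (Fin 2 × Grid n) ℂ :=
  ketbra ketLeft ⊗ₖ shift n (-1, 0) + ketbra ketRight ⊗ₖ shift n (1, 0)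

/-- One step `U` of the walk without marked vertex: first up/down, then left/right. -/
noncomputable def walk (n : ℕ) [NeZero n] : Matrix (Fin 2 × Grid n) (Fin 2 × Grid n) ℂ :=
  moveLeftRight n * moveUpDown n

/-- The state `|s, v⟩`. -/
noncomputable def ketSV (n : ℕ) (v : Grid n) : Fin 2 × Grid n → ℂ :=
  fun p => if p.2 = v then ketS p.1 else 0

/-- One step `U' = U (I - 2 |s, v⟩⟨s, v|)` of the walk with marked vertex `v`. -/
noncomputable def markedWalk (n : ℕ) [NeZero n] (v : Grid n) :
    Matrix (Fin 2 × Grid n) (Fin 2 × Grid n) ℂ :=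
  walk n * (1 - (2 : ℂ) • ketbra (ketSV n v))

/-- The uniform superposition over all coin states and all vertices. -/
noncomputable def uniformState (n : ℕ) [NeZero n] : Fin 2 × Grid n → ℂ :=
  fun _ => ((√(Fintype.card (Fin 2 × Grid n) : ℝ) : ℝ) : ℂ)⁻¹

/-- The success probability of the quantum walk search algorithm: start in the uniform
superposition, apply the marked walk `T` times, measure the vertex register. -/
noncomputable def walkSuccess (n : ℕ) [NeZero n] (v : Grid n) (T : ℕ) : ℝ :=
  probAt ((markedWalk n v ^ T) *ᵥ uniformState n) v

/-! ### Local quantum search algorithms on a graph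

The state space is spanned by `|i⟩|v⟩` with `i : ι` an internal basis state and `v : V` a
vertex; the input is a bit `a v` for every vertex `v`. -/

/-- A transformation is `Z`-local on `G` if it maps every state located at a vertex `v` to a
state supported on `v` and the neighbours of `v`. -/
def IsZLocal {ι V : Type*} (G : SimpleGraph V) (U : Matrix (ι × V) (ι × V) ℂ) : Prop :=
  ∀ i j v w, U (j, w) (i, v) ≠ 0 → w = v ∨ G.Adj v w

/-- One step of a local algorithm: a query, which applies the first unitary to the internal
register at the vertices with `a v = 0` and the second one at those with `a v = 1`, or a
`Z`-local unitary, which does not depend on the input. -/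
inductive Step (ι : Type) {V : Type} [Fintype ι] [DecidableEq ι] [Fintype V] [DecidableEq V]
    (G : SimpleGraph V) : Type
  | query (U₀ U₁ : Matrix.unitaryGroup ι ℂ) : Step ι G
  | localStep (U : Matrix.unitaryGroup (ι × V) ℂ) (hU : IsZLocal G U.1) : Step ι G

section Algorithm

variable {ι V : Type} [Fintype ι] [DecidableEq ι] [Fintype V] [DecidableEq V]
  {G : SimpleGraph V}

/-- The operator that a step applies on input `a`. -/
def Step.op (a : V → Bool) : Step ι G → Matrix (ι × V) (ι × V) ℂ
  | .query U₀ U₁ => Matrix.of fun p q =>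
      if p.2 = q.2 then (if a q.2 then U₁.1 p.1 q.1 else U₀.1 p.1 q.1) else 0
  | .localStep U _ => U.1

/-- The final state `U_t ⋯ U_1 ψ` of the algorithm with steps `U_1, …, U_t` (in the order
of the list) and starting state `ψ`, on input `a`. -/
def finalState (steps : List (Step ι G)) (ψ : ι × V → ℂ) (a : V → Bool) : ι × V → ℂ :=
  steps.foldl (fun φ s => s.op a *ᵥ φ) ψ

/-- The probability that measuring the vertex register of the final state gives a vertex `v`
with `a v = 1`. -/
noncomputable def algorithmSuccess (steps : List (Step ι G)) (ψ : ι × V → ℂ)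
    (a : V → Bool) : ℝ :=
  ∑ v, if a v then probAt (finalState steps ψ a) v else 0

end Algorithm

/-- The state `|⇑⟩|0, 0⟩`, located at a single vertex. -/
noncomputable def originState (n : ℕ) : Fin 2 × Grid n → ℂ :=
  fun p => if p.2 = (0, 0) then ketUp p.1 else 0

end GridSearch

/-! Write `U` for the walk, `φ = |s, v⟩` and `η = (1 - z U⋆)⁻¹ φ` with `z < 1`. Pairing one step of
the marked walk with `η` gives `z ⟨η, U'ψ⟩ = ⟨η, ψ⟩ - (2 ⟨η, φ⟩ - 1) ⟨φ, ψ⟩`, which telescopes: the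
weighted sum of the amplitudes `⟨φ, U'ᵗ u⟩` over `t < T` is determined by `⟨η, u⟩`, up to an error
of size `zᵀ ‖η‖`. The uniform state `u` is fixed by `U`, so `⟨η, u⟩ = ⟨φ, u⟩ / (1 - z)`, and one of
the amplitudes is large unless `‖η‖` is.

The operator `U + U⋆` does not see the coin: it is twice the diagonal random walk on the grid. Hence
`η` is expressed by the Green function of that random walk, and `‖η‖²` is its value at `0`, which a
lattice sum over Fourier modes bounds by `O(log N)` when `z = 1 - 1 / √(N log N)`. This makes some
amplitude among the first `O(√(N log N))` of size `Ω(1 / √log N)`; translation invariance makes the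
number of steps independent of `v`.

For constant success probability, prepare `u` from a single vertex by local steps that extend a
uniform ramp along each axis, in `O(√N)` steps, and apply amplitude amplification for `O(√log N)`
rounds; the reflection about the starting state is itself local.
-/

namespace GridSearch

/-! ### Vectors and reflections -/

section Vectors

variable {m : Type*} [Fintype m]

/-- The squared Euclidean norm of a complex vector. Functions `m → ℂ` carry the supremum norm in
Mathlib, so it is written out. -/
noncomputable def sqNorm (x : m → ℂ) : ℝ := ∑ i, ‖x i‖ ^ 2

lemma sqNorm_eq_norm_toLp_sq (x : m → ℂ) : sqNorm x = ‖WithLp.toLp 2 x‖ ^ 2 :=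
  (EuclideanSpace.norm_sq_eq _).symm

lemma sqNorm_nonneg (x : m → ℂ) : 0 ≤ sqNorm x :=
  Finset.sum_nonneg fun _ _ => by positivity

lemma sqNorm_eq_zero {x : m → ℂ} : sqNorm x = 0 ↔ x = 0 := by
  simp [sqNorm_eq_norm_toLp_sq]

lemma star_dotProduct_self (x : m → ℂ) : star x ⬝ᵥ x = (sqNorm x : ℂ) := by
  simp only [dotProduct, sqNorm, Pi.star_apply, RCLike.star_def, Complex.conj_mul',
    Complex.ofReal_sum, Complex.ofReal_pow]

lemma norm_star_dotProduct_le (x y : m → ℂ) :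
    ‖star x ⬝ᵥ y‖ ≤ √(sqNorm x) * √(sqNorm y) := by
  simpa [sqNorm_eq_norm_toLp_sq, EuclideanSpace.inner_toLp_toLp, dotProduct_comm] using
    norm_inner_le_norm (𝕜 := ℂ) (WithLp.toLp 2 x) (WithLp.toLp 2 y)

lemma star_dotProduct_mulVec (A : Matrix m m ℂ) (x y : m → ℂ) :
    star x ⬝ᵥ (A *ᵥ y) = star (Aᴴ *ᵥ x) ⬝ᵥ y := by
  rw [Matrix.star_mulVec, Matrix.conjTranspose_conjTranspose, Matrix.dotProduct_mulVec]

lemma ketbra_mulVec (a x : m → ℂ) : ketbra a *ᵥ x = (star a ⬝ᵥ x) • a := by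
  rw [ketbra, Matrix.vecMulVec_mulVec, op_smul_eq_smul]

lemma conjTranspose_ketbra {m : Type*} (a : m → ℂ) : (ketbra a)ᴴ = ketbra a := by
  rw [ketbra, Matrix.conjTranspose_vecMulVec, star_star]

lemma ketbra_mul_ketbra (a b : m → ℂ) :
    ketbra a * ketbra b = (star a ⬝ᵥ b) • Matrix.vecMulVec a (star b) := by
  rw [ketbra, ketbra, Matrix.vecMulVec_mul_vecMulVec, Matrix.vecMulVec_smul]

lemma ketbra_mul_self (a : m → ℂ) : ketbra a * ketbra a = (sqNorm a : ℂ) • ketbra a := by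
  rw [ketbra_mul_ketbra, star_dotProduct_self, ketbra]

lemma ketbra_mul_ketbra_of_orthogonal {a b : m → ℂ} (h : star a ⬝ᵥ b = 0) :
    ketbra a * ketbra b = 0 := by
  rw [ketbra_mul_ketbra, h, zero_smul]

variable [DecidableEq m]

lemma sqNorm_mulVec {A : Matrix m m ℂ} (hA : A ∈ Matrix.unitaryGroup m ℂ) (x : m → ℂ) :
    sqNorm (A *ᵥ x) = sqNorm x := by
  have h : star (A *ᵥ x) ⬝ᵥ (A *ᵥ x) = star x ⬝ᵥ x := by
    rw [star_dotProduct_mulVec, Matrix.mulVec_mulVec, ← Matrix.star_eq_conjTranspose,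
      Matrix.mem_unitaryGroup_iff'.1 hA, Matrix.one_mulVec]
  simpa only [star_dotProduct_self, Complex.ofReal_inj] using h

lemma ketbra_mulVec_mul {S : Matrix m m ℂ} (hS : S ∈ Matrix.unitaryGroup m ℂ) (a : m → ℂ) :
    ketbra (S *ᵥ a) * S = S * ketbra a := by
  rw [ketbra, ketbra, Matrix.star_mulVec, Matrix.vecMulVec_mul, Matrix.vecMul_vecMul,
    ← Matrix.star_eq_conjTranspose, Matrix.mem_unitaryGroup_iff'.1 hS, Matrix.vecMul_one,
    Matrix.mul_vecMulVec]

/-- The reflection in the hyperplane orthogonal to `w`; for `w = 0` it is the identity, because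
`2 / 0 = 0`. -/
noncomputable def reflection (w : m → ℂ) : Matrix m m ℂ :=
  1 - ((2 / sqNorm w : ℝ) : ℂ) • ketbra w

lemma reflection_of_sqNorm_eq_one {w : m → ℂ} (hw : sqNorm w = 1) :
    reflection w = 1 - (2 : ℂ) • ketbra w := by
  simp [reflection, hw]

lemma conjTranspose_reflection (w : m → ℂ) : (reflection w)ᴴ = reflection w := by
  rw [reflection, Matrix.conjTranspose_sub, Matrix.conjTranspose_one, Matrix.conjTranspose_smul,
    conjTranspose_ketbra, Complex.star_def, Complex.conj_ofReal]

lemma reflection_mul_self (w : m → ℂ) : reflection w * reflection w = 1 := by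
  set r := 2 / sqNorm w with hr
  have hr' : r * r * sqNorm w = 2 * r := by
    rcases eq_or_ne (sqNorm w) 0 with h | h
    · simp [hr, h]
    · rw [hr]; field_simp
  have hc : (r : ℂ) * r * sqNorm w = 2 * r := mod_cast hr'
  rw [reflection, ← hr, sub_mul, mul_sub, mul_sub, one_mul, mul_one, one_mul, smul_mul_smul_comm,
    ketbra_mul_self, smul_smul, hc, two_mul, add_smul]
  abel

lemma reflection_mem_unitaryGroup (w : m → ℂ) : reflection w ∈ Matrix.unitaryGroup m ℂ := by
  rw [Matrix.mem_unitaryGroup_iff, Matrix.star_eq_conjTranspose, conjTranspose_reflection,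
    reflection_mul_self]

lemma reflection_mulVec_mul {S : Matrix m m ℂ} (hS : S ∈ Matrix.unitaryGroup m ℂ) (w : m → ℂ) :
    reflection (S *ᵥ w) * S = S * reflection w := by
  rw [reflection, reflection, sqNorm_mulVec hS, sub_mul, mul_sub, one_mul, mul_one, smul_mul_assoc,
    mul_smul_comm, ketbra_mulVec_mul hS]

lemma reflection_sub_mulVec {a b : m → ℂ} (hnorm : sqNorm a = sqNorm b)
    (hsymm : star a ⬝ᵥ b = star b ⬝ᵥ a) : reflection (a - b) *ᵥ a = b := by
  have hN : (sqNorm (a - b) : ℂ) = 2 * (star (a - b) ⬝ᵥ a) := by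
    rw [← star_dotProduct_self, star_sub, sub_dotProduct, sub_dotProduct, dotProduct_sub,
      dotProduct_sub, hsymm, star_dotProduct_self, star_dotProduct_self, hnorm]
    ring
  rw [reflection, Matrix.sub_mulVec, Matrix.one_mulVec, Matrix.smul_mulVec, ketbra_mulVec,
    smul_smul]
  rcases eq_or_ne (sqNorm (a - b)) 0 with h | h
  · simp [sub_eq_zero.1 (sqNorm_eq_zero.1 h)]
  · have h1 : ((2 / sqNorm (a - b) : ℝ) : ℂ) * (star (a - b) ⬝ᵥ a) = 1 := by
      have : (sqNorm (a - b) : ℂ) ≠ 0 := mod_cast h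
      push_cast
      rw [div_mul_eq_mul_div, ← hN, div_self this]
    rw [h1, one_smul, sub_sub_cancel]

lemma eq_or_ne_zero_of_reflection_apply_ne_zero {w : m → ℂ} {i j : m}
    (h : reflection w i j ≠ 0) : i = j ∨ w i ≠ 0 ∧ w j ≠ 0 := by
  contrapose! h
  have hw : w i * star (w j) = 0 := by
    rcases eq_or_ne (w i) 0 with hi | hi
    · rw [hi, zero_mul]
    · rw [h.2 hi, star_zero, mul_zero]
  rw [reflection, Matrix.sub_apply, Matrix.one_apply_ne h.1, Matrix.smul_apply, ketbra,
    Matrix.vecMulVec_apply, Pi.star_apply, hw, smul_zero, sub_zero]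

end Vectors

section Tensor

variable {m k : Type*}

/-- The product vector `a ⊗ b`. -/
def tensor (a : m → ℂ) (b : k → ℂ) : m × k → ℂ := fun p => a p.1 * b p.2

variable [Fintype m] [Fintype k]

lemma kronecker_mulVec_tensor (A : Matrix m m ℂ) (B : Matrix k k ℂ) (a : m → ℂ) (b : k → ℂ) :
    (A ⊗ₖ B) *ᵥ tensor a b = tensor (A *ᵥ a) (B *ᵥ b) := by
  ext p
  simp only [Matrix.mulVec, dotProduct, tensor, Fintype.sum_prod_type, Matrix.kroneckerMap_apply,
    Finset.sum_mul_sum]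
  exact Finset.sum_congr rfl fun _ _ => Finset.sum_congr rfl fun _ _ => by ring

lemma star_tensor_dotProduct_tensor (a a' : m → ℂ) (b b' : k → ℂ) :
    star (tensor a b) ⬝ᵥ tensor a' b' = (star a ⬝ᵥ a') * (star b ⬝ᵥ b') := by
  simp only [dotProduct, tensor, Fintype.sum_prod_type, Finset.sum_mul_sum, Pi.star_apply,
    star_mul']
  exact Finset.sum_congr rfl fun _ _ => Finset.sum_congr rfl fun _ _ => by ring

lemma sqNorm_tensor (a : m → ℂ) (b : k → ℂ) : sqNorm (tensor a b) = sqNorm a * sqNorm b := by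
  exact_mod_cast (star_dotProduct_self (tensor a b)).symm.trans
    ((star_tensor_dotProduct_tensor a a b b).trans
      (congrArg₂ _ (star_dotProduct_self a) (star_dotProduct_self b)))

end Tensor

/-! ### Searching with a marked reflection -/

section Search

variable {m : Type*} [Fintype m] {U : Matrix m m ℂ} {u φ η : m → ℂ} {z : ℝ}

lemma resolvent_dual_dotProduct (hη : η - (z : ℂ) • (Uᴴ *ᵥ η) = φ) (x : m → ℂ) :
    (z : ℂ) * (star η ⬝ᵥ (U *ᵥ x)) = star η ⬝ᵥ x - star φ ⬝ᵥ x := by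
  rw [← hη, star_dotProduct_mulVec, star_sub, star_smul, sub_dotProduct, smul_dotProduct,
    Complex.star_def, Complex.conj_ofReal, smul_eq_mul, sub_sub_cancel]

variable [DecidableEq m]

/-- One step of a search: the query `1 - 2 |φ⟩⟨φ|`, then the walk `U`. -/
noncomputable def searchStep (U : Matrix m m ℂ) (φ : m → ℂ) : Matrix m m ℂ :=
  U * (1 - (2 : ℂ) • ketbra φ)

lemma searchStep_mem_unitaryGroup (hU : U ∈ Matrix.unitaryGroup m ℂ) (hφ : sqNorm φ = 1) :
    searchStep U φ ∈ Matrix.unitaryGroup m ℂ := by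
  rw [searchStep, ← reflection_of_sqNorm_eq_one hφ]
  exact mul_mem hU (reflection_mem_unitaryGroup φ)

lemma semiconjBy_searchStep {S : Matrix m m ℂ} (hS : S ∈ Matrix.unitaryGroup m ℂ)
    (hSU : Commute S U) (φ : m → ℂ) :
    SemiconjBy S (searchStep U φ) (searchStep U (S *ᵥ φ)) := by
  refine SemiconjBy.mul_right hSU ?_
  rw [SemiconjBy, mul_sub, sub_mul, mul_one, one_mul, Matrix.mul_smul, Matrix.smul_mul,
    ketbra_mulVec_mul hS]

lemma resolvent_dual_searchStep (hφ : sqNorm φ = 1) (hη : η - (z : ℂ) • (Uᴴ *ᵥ η) = φ)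
    (x : m → ℂ) :
    (z : ℂ) * (star η ⬝ᵥ (searchStep U φ *ᵥ x)) =
      star η ⬝ᵥ x - (2 * (star η ⬝ᵥ φ) - 1) * (star φ ⬝ᵥ x) := by
  rw [searchStep, ← Matrix.mulVec_mulVec, Matrix.sub_mulVec, Matrix.one_mulVec,
    Matrix.smul_mulVec, ketbra_mulVec, resolvent_dual_dotProduct hη]
  simp only [dotProduct_sub, dotProduct_smul, star_dotProduct_self, hφ, smul_eq_mul,
    Complex.ofReal_one]
  ring

lemma resolvent_dual_sum (hφ : sqNorm φ = 1) (hη : η - (z : ℂ) • (Uᴴ *ᵥ η) = φ) (T : ℕ) :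
    (2 * (star η ⬝ᵥ φ) - 1) *
        ∑ t ∈ Finset.range T, (z : ℂ) ^ t * (star φ ⬝ᵥ (searchStep U φ ^ t *ᵥ u)) =
      star η ⬝ᵥ u - (z : ℂ) ^ T * (star η ⬝ᵥ (searchStep U φ ^ T *ᵥ u)) := by
  induction T with
  | zero => simp
  | succ T ih =>
    have h := resolvent_dual_searchStep hφ hη (searchStep U φ ^ T *ᵥ u)
    rw [Matrix.mulVec_mulVec, ← pow_succ'] at h
    rw [Finset.sum_range_succ, mul_add, ih, pow_succ (z : ℂ), mul_assoc _ (z : ℂ), h]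
    ring

lemma resolvent_dual_re (hU : U ∈ Matrix.unitaryGroup m ℂ) (hφ : sqNorm φ = 1)
    (hη : η - (z : ℂ) • (Uᴴ *ᵥ η) = φ) :
    2 * (star η ⬝ᵥ φ).re - 1 = (1 - z ^ 2) * sqNorm η := by
  have hU' : Uᴴ ∈ Matrix.unitaryGroup m ℂ := Unitary.star_mem hU
  have hsub : (z : ℂ) • (Uᴴ *ᵥ η) = η - φ := by rw [← hη, sub_sub_cancel]
  have hnorm : (z : ℂ) ^ 2 * sqNorm η =
      sqNorm η - star η ⬝ᵥ φ - star (star η ⬝ᵥ φ) + 1 := by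
    calc (z : ℂ) ^ 2 * sqNorm η = star ((z : ℂ) • (Uᴴ *ᵥ η)) ⬝ᵥ ((z : ℂ) • (Uᴴ *ᵥ η)) := by
          rw [star_smul, smul_dotProduct, dotProduct_smul, star_dotProduct_self,
            sqNorm_mulVec hU', Complex.star_def, Complex.conj_ofReal, smul_eq_mul, smul_eq_mul]
          ring
      _ = _ := by
          rw [hsub, star_sub, sub_dotProduct, dotProduct_sub, dotProduct_sub,
            star_dotProduct_self, star_dotProduct_self, hφ, Matrix.star_dotProduct φ η,
            Complex.ofReal_one]
          ring
  have hre := congrArg Complex.re hnorm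
  simp only [← Complex.ofReal_pow, Complex.re_ofReal_mul, Complex.ofReal_re, Complex.add_re,
    Complex.sub_re, Complex.star_def, Complex.conj_re, Complex.one_re] at hre
  linarith

lemma norm_overlap_div_le (hU : U ∈ Matrix.unitaryGroup m ℂ) (hu : U *ᵥ u = u)
    (hu1 : sqNorm u = 1) (hφ : sqNorm φ = 1) (hz0 : 0 ≤ z) (hz1 : z < 1)
    (hη : η - (z : ℂ) • (Uᴴ *ᵥ η) = φ) (him : (star η ⬝ᵥ φ).im = 0) (T : ℕ) :
    ‖star φ ⬝ᵥ u‖ / (1 - z) ≤ (1 - z ^ 2) * sqNorm η *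
      ∑ t ∈ Finset.range T, ‖star φ ⬝ᵥ (searchStep U φ ^ t *ᵥ u)‖ + z ^ T * √(sqNorm η) := by
  have hinit : ‖star η ⬝ᵥ u‖ = ‖star φ ⬝ᵥ u‖ / (1 - z) := by
    have h : ((1 - z : ℝ) : ℂ) * (star η ⬝ᵥ u) = star φ ⬝ᵥ u := by
      have := resolvent_dual_dotProduct hη u
      rw [hu] at this
      push_cast
      linear_combination -this
    rw [← h, norm_mul, Complex.norm_of_nonneg (by linarith),
      mul_div_cancel_left₀ _ (by linarith)]
  have hfinal : ‖star η ⬝ᵥ (searchStep U φ ^ T *ᵥ u)‖ ≤ √(sqNorm η) := by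
    simpa [sqNorm_mulVec (pow_mem (searchStep_mem_unitaryGroup hU hφ) T), hu1] using
      norm_star_dotProduct_le η (searchStep U φ ^ T *ᵥ u)
  have hD : ‖2 * (star η ⬝ᵥ φ) - 1‖ = (1 - z ^ 2) * sqNorm η := by
    have hreal : 2 * (star η ⬝ᵥ φ) - 1 = (((1 - z ^ 2) * sqNorm η : ℝ) : ℂ) := by
      rw [← resolvent_dual_re hU hφ hη]
      apply Complex.ext <;> simp [him]
    rw [hreal, Complex.norm_of_nonneg (mul_nonneg (by nlinarith) (sqNorm_nonneg η))]
  have hz : ∀ t, ‖(z : ℂ) ^ t‖ = z ^ t := fun t => by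
    rw [norm_pow, Complex.norm_of_nonneg hz0]
  calc ‖star φ ⬝ᵥ u‖ / (1 - z)
      = ‖(2 * (star η ⬝ᵥ φ) - 1) * ∑ t ∈ Finset.range T,
            (z : ℂ) ^ t * (star φ ⬝ᵥ (searchStep U φ ^ t *ᵥ u)) +
          (z : ℂ) ^ T * (star η ⬝ᵥ (searchStep U φ ^ T *ᵥ u))‖ := by
        rw [resolvent_dual_sum hφ hη, sub_add_cancel, hinit]
    _ ≤ _ := by
        refine (norm_add_le _ _).trans (add_le_add ?_ ?_)
        · rw [norm_mul, hD]
          refine mul_le_mul_of_nonneg_left (norm_sum_le_of_le _ fun t _ => ?_)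
            (mul_nonneg (by nlinarith) (sqNorm_nonneg η))
          rw [norm_mul, hz]
          exact mul_le_of_le_one_left (norm_nonneg _) (pow_le_one₀ hz0 hz1.le)
        · rw [norm_mul, hz]
          gcongr

lemma one_sub_inv_pow_le {R : ℝ} (hR : 1 ≤ R) {T : ℕ} (hT : 3 * R ≤ T) :
    (1 - R⁻¹) ^ T ≤ 1 / 16 := by
  have hR0 : 0 < R := by linarith
  have he : 16 ≤ Real.exp 3 := by
    have h := Real.exp_one_gt_d9
    calc (16 : ℝ) ≤ 2.7 ^ 3 := by norm_num
      _ ≤ Real.exp 1 ^ 3 := by gcongr; linarith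
      _ = Real.exp 3 := by rw [← Real.exp_nat_mul]; norm_num
  calc (1 - R⁻¹) ^ T ≤ Real.exp (-R⁻¹) ^ T := by
        have : R⁻¹ ≤ 1 := inv_le_one_of_one_le₀ hR
        exact pow_le_pow_left₀ (sub_nonneg.2 this) (Real.one_sub_le_exp_neg _) T
    _ = Real.exp (-(T / R)) := by rw [← Real.exp_nat_mul]; congr 1; ring
    _ ≤ Real.exp (-3) := by
        gcongr
        exact (le_div_iff₀ hR0).2 hT
    _ ≤ 1 / 16 := by
        rw [Real.exp_neg, one_div]
        gcongr

lemma exists_term_ge_of_weighted_sum_ge {a : ℕ → ℝ} {R G δ : ℝ} (hR : 1 ≤ R)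
    (hδ : √G ≤ 8 * R * δ)
    (h : ∀ T : ℕ, R * δ ≤ 2 * R⁻¹ * G * ∑ t ∈ Finset.range T, a t + (1 - R⁻¹) ^ T * √G) :
    ∃ t : ℕ, t ≤ 4 * R ∧ R * δ ≤ 16 * G * a t := by
  have : 0 < R := by linarith
  obtain ⟨T, hTge, hTle⟩ : ∃ T : ℕ, 3 * R ≤ T ∧ T ≤ 4 * R :=
    ⟨⌈3 * R⌉₊, Nat.le_ceil _, by linarith [Nat.ceil_lt_add_one (a := 3 * R) (by linarith)]⟩
  have hT0 : (0 : ℝ) < T := by linarith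
  have htail : (1 - R⁻¹) ^ T * √G ≤ R * δ / 2 := by
    calc (1 - R⁻¹) ^ T * √G ≤ 1 / 16 * (8 * R * δ) :=
          mul_le_mul (one_sub_inv_pow_le hR hTge) hδ (Real.sqrt_nonneg _) (by norm_num)
      _ = R * δ / 2 := by ring
  have hsum : ∑ _t ∈ Finset.range T, R * δ / (2 * T) ≤
      ∑ t ∈ Finset.range T, 2 * R⁻¹ * G * a t := by
    calc ∑ _t ∈ Finset.range T, R * δ / (2 * T) = R * δ / 2 := by
          rw [Finset.sum_const, Finset.card_range, nsmul_eq_mul]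
          field_simp
      _ ≤ 2 * R⁻¹ * G * ∑ t ∈ Finset.range T, a t := by linarith [h T]
      _ = ∑ t ∈ Finset.range T, 2 * R⁻¹ * G * a t := Finset.mul_sum ..
  obtain ⟨t, ht, hle⟩ := Finset.exists_le_of_sum_le
    (Finset.nonempty_range_iff.2 (Nat.cast_pos.1 hT0).ne') hsum
  have htT : (t : ℝ) ≤ T := mod_cast (Finset.mem_range.1 ht).le
  refine ⟨t, htT.trans hTle, ?_⟩
  have hδ0 : 0 ≤ R * δ := by linarith [Real.sqrt_nonneg G]
  calc R * δ = 8 * R * (R * δ / (2 * (4 * R))) := by field_simp; ring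
    _ ≤ 8 * R * (R * δ / (2 * T)) := by gcongr
    _ ≤ 8 * R * (2 * R⁻¹ * G * a t) := by gcongr
    _ = 16 * G * a t := by field_simp; ring

theorem exists_amplitude_ge {R : ℝ} (hR : 1 ≤ R) (hU : U ∈ Matrix.unitaryGroup m ℂ)
    (hu : U *ᵥ u = u) (hu1 : sqNorm u = 1) (hφ : sqNorm φ = 1)
    (hη : η - ((1 - R⁻¹ : ℝ) : ℂ) • (Uᴴ *ᵥ η) = φ) (him : (star η ⬝ᵥ φ).im = 0)
    (hb : √(sqNorm η) ≤ 8 * R * ‖star φ ⬝ᵥ u‖) :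
    ∃ t : ℕ, t ≤ 4 * R ∧
      R * ‖star φ ⬝ᵥ u‖ ≤ 16 * sqNorm η * ‖star φ ⬝ᵥ (searchStep U φ ^ t *ᵥ u)‖ := by
  refine exists_term_ge_of_weighted_sum_ge hR hb fun T => ?_
  have hRi : 0 < R⁻¹ := inv_pos.2 (by linarith)
  have hRi1 : R⁻¹ ≤ 1 := inv_le_one_of_one_le₀ hR
  have h := norm_overlap_div_le hU hu hu1 hφ (by linarith) (by linarith) hη him T
  rw [sub_sub_cancel, div_inv_eq_mul, mul_comm] at h
  refine h.trans (add_le_add_left ?_ _)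
  have hcoef : 1 - (1 - R⁻¹) ^ 2 ≤ 2 * R⁻¹ := by nlinarith
  exact mul_le_mul_of_nonneg_right (mul_le_mul_of_nonneg_right hcoef (sqNorm_nonneg η))
    (Finset.sum_nonneg fun _ _ => norm_nonneg _)

end Search

/-! ### The quantum walk on the grid -/

section Walk

variable {ι : Type*} {n : ℕ}

lemma conjTranspose_shift (g : Grid n) : (shift n g)ᴴ = shift n (-g) := by
  ext v w
  simp [shift, apply_ite, eq_add_neg_iff_add_eq, eq_comm]

lemma shift_zero : shift n 0 = 1 := by
  ext v w
  simp [shift, Matrix.one_apply]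

/-- The conditional move that translates by `g` on the coin state `a` and by `h` on the coin
state `b`; both halves of a step of the walk are of this form. -/
noncomputable def condMove (n : ℕ) (a b : ι → ℂ) (g h : Grid n) :
    Matrix (ι × Grid n) (ι × Grid n) ℂ :=
  ketbra a ⊗ₖ shift n g + ketbra b ⊗ₖ shift n h

lemma conjTranspose_condMove (a b : ι → ℂ) (g h : Grid n) :
    (condMove n a b g h)ᴴ = condMove n a b (-g) (-h) := by
  simp only [condMove, Matrix.conjTranspose_add, Matrix.conjTranspose_kronecker,
    conjTranspose_ketbra, conjTranspose_shift]

lemma inv_sqrt_two_mul_self : ((√2 : ℝ) : ℂ)⁻¹ * ((√2 : ℝ) : ℂ)⁻¹ = 1 / 2 := by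
  rw [← mul_inv, ← Complex.ofReal_mul, Real.mul_self_sqrt (by norm_num)]
  norm_num

lemma ketS_eq : ketS = fun _ => ((√2 : ℝ) : ℂ)⁻¹ := by
  ext i
  fin_cases i <;> simp [ketS, ketUp, ketDown]

lemma sqNorm_ketUp : sqNorm ketUp = 1 := by
  simp [sqNorm, ketUp]

lemma sqNorm_ketS : sqNorm ketS = 1 := by
  simp [sqNorm, ketS_eq]

lemma ketbra_ketUp : ketbra ketUp = !![1, 0; 0, 0] := by
  ext i j
  fin_cases i <;> fin_cases j <;> simp [ketbra, ketUp, Matrix.vecMulVec_apply]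

lemma ketbra_ketDown : ketbra ketDown = !![0, 0; 0, 1] := by
  ext i j
  fin_cases i <;> fin_cases j <;> simp [ketbra, ketDown, Matrix.vecMulVec_apply]

lemma ketbra_ketLeft : ketbra ketLeft = (1 / 2 : ℂ) • !![1, 1; 1, 1] := by
  rw [← inv_sqrt_two_mul_self]
  ext i j
  fin_cases i <;> fin_cases j <;>
    simp [ketbra, ketLeft, ketUp, ketDown, Matrix.vecMulVec_apply]

lemma ketbra_ketRight : ketbra ketRight = (1 / 2 : ℂ) • !![1, -1; -1, 1] := by
  rw [← inv_sqrt_two_mul_self]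
  ext i j
  fin_cases i <;> fin_cases j <;>
    simp [ketbra, ketRight, ketUp, ketDown, Matrix.vecMulVec_apply]

lemma ketbra_ketUp_add_ketbra_ketDown : ketbra ketUp + ketbra ketDown = 1 := by
  rw [ketbra_ketUp, ketbra_ketDown, Matrix.one_fin_two]
  simp

lemma ketbra_ketLeft_add_ketbra_ketRight : ketbra ketLeft + ketbra ketRight = 1 := by
  rw [ketbra_ketLeft, ketbra_ketRight, Matrix.one_fin_two, ← smul_add]
  norm_num

lemma moveUpDown_eq (n : ℕ) : moveUpDown n = condMove n ketUp ketDown (0, -1) (0, 1) := rfl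

lemma moveLeftRight_eq (n : ℕ) :
    moveLeftRight n = condMove n ketLeft ketRight (-1, 0) (1, 0) := rfl

lemma ketSV_eq_tensor (v : Grid n) : ketSV n v = tensor ketS (Pi.single v 1) := by
  ext p
  simp [ketSV, tensor, Pi.single_apply]

lemma originState_eq_tensor : originState n = tensor ketUp (Pi.single 0 1) := by
  ext p
  simp [originState, tensor, Pi.single_apply, Prod.zero_eq_mk]

variable [Fintype ι]

lemma star_tensor_single_dotProduct {V : Type*} [Fintype V] [DecidableEq V] (a : ι → ℂ) (v : V)
    (ψ : ι × V → ℂ) :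
    star (tensor a (Pi.single v 1)) ⬝ᵥ ψ = star a ⬝ᵥ fun i => ψ (i, v) := by
  simp [dotProduct, tensor, Fintype.sum_prod_type, Pi.single_apply, apply_ite]

lemma sqNorm_single {V : Type*} [Fintype V] [DecidableEq V] (v : V) :
    sqNorm (Pi.single v (1 : ℂ)) = 1 := by
  simp [sqNorm, Pi.single_apply, apply_ite]

variable [NeZero n]

lemma shift_mulVec_apply (g : Grid n) (f : Grid n → ℂ) (w : Grid n) :
    (shift n g *ᵥ f) w = f (w - g) := by
  simp [shift, Matrix.mulVec, dotProduct, ← sub_eq_iff_eq_add]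

lemma shift_mulVec_single (g v : Grid n) :
    shift n g *ᵥ Pi.single v 1 = Pi.single (v + g) 1 := by
  ext w
  simp [shift_mulVec_apply, Pi.single_apply, sub_eq_iff_eq_add]

lemma shift_mul_shift (g h : Grid n) : shift n g * shift n h = shift n (g + h) := by
  ext v w
  simp [shift, Matrix.mul_apply, add_assoc, add_comm h]

lemma shift_mem_unitaryGroup (g : Grid n) : shift n g ∈ Matrix.unitaryGroup (Grid n) ℂ := by
  rw [Matrix.mem_unitaryGroup_iff, Matrix.star_eq_conjTranspose, conjTranspose_shift,
    shift_mul_shift, add_neg_cancel, shift_zero]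

lemma one_kronecker_shift_mulVec_apply [DecidableEq ι] (g : Grid n) (ψ : ι × Grid n → ℂ) (i : ι)
    (w : Grid n) : (((1 : Matrix ι ι ℂ) ⊗ₖ shift n g) *ᵥ ψ) (i, w) = ψ (i, w - g) := by
  simp [shift, Matrix.mulVec, dotProduct, Fintype.sum_prod_type, Matrix.one_apply,
    ← sub_eq_iff_eq_add]

lemma probAt_one_kronecker_shift [DecidableEq ι] (g : Grid n) (ψ : ι × Grid n → ℂ) (w : Grid n) :
    probAt (((1 : Matrix ι ι ℂ) ⊗ₖ shift n g) *ᵥ ψ) w = probAt ψ (w - g) := by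
  simp only [probAt, one_kronecker_shift_mulVec_apply]

lemma commute_one_kronecker_shift_condMove [DecidableEq ι] (a b : ι → ℂ) (v g h : Grid n) :
    Commute ((1 : Matrix ι ι ℂ) ⊗ₖ shift n v) (condMove n a b g h) := by
  simp only [Commute, SemiconjBy, condMove, mul_add, add_mul, ← Matrix.mul_kronecker_mul,
    shift_mul_shift, one_mul, mul_one, add_comm v]

lemma condMove_mem_unitaryGroup [DecidableEq ι] {a b : ι → ℂ} (hab : star a ⬝ᵥ b = 0)
    (h1 : ketbra a + ketbra b = 1) (g h : Grid n) :
    condMove n a b g h ∈ Matrix.unitaryGroup (ι × Grid n) ℂ := by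
  have hab' : ketbra a * ketbra b = 0 := ketbra_mul_ketbra_of_orthogonal hab
  have hba' : ketbra b * ketbra a = 0 := by
    rw [← conjTranspose_ketbra a, ← conjTranspose_ketbra b, ← Matrix.conjTranspose_mul, hab',
      Matrix.conjTranspose_zero]
  have haa : ketbra a * ketbra a = ketbra a := by
    rw [← add_zero (ketbra a * ketbra a), ← hab', ← mul_add, h1, mul_one]
  have hbb : ketbra b * ketbra b = ketbra b := by
    rw [← zero_add (ketbra b * ketbra b), ← hba', ← mul_add, h1, mul_one]
  rw [Matrix.mem_unitaryGroup_iff, Matrix.star_eq_conjTranspose, conjTranspose_condMove]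
  simp only [condMove, add_mul, mul_add, ← Matrix.mul_kronecker_mul, hab', hba', haa, hbb,
    shift_mul_shift, add_neg_cancel, shift_zero, Matrix.zero_kronecker, add_zero, zero_add]
  rw [← Matrix.add_kronecker, h1, Matrix.one_kronecker_one]

lemma condMove_mulVec_tensor_const [DecidableEq ι] {a b : ι → ℂ} (h1 : ketbra a + ketbra b = 1)
    (g h : Grid n) (x : ι → ℂ) (c : ℂ) :
    condMove n a b g h *ᵥ tensor x (fun _ => c) = tensor x fun _ => c := by
  have hshift : ∀ g : Grid n, (shift n g *ᵥ fun _ => c) = fun _ => c := fun g =>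
    funext fun w => shift_mulVec_apply g _ w
  rw [condMove, Matrix.add_mulVec, kronecker_mulVec_tensor, kronecker_mulVec_tensor, hshift,
    hshift]
  ext p
  rw [Pi.add_apply, tensor, tensor, ← add_mul, ← Pi.add_apply, ← Matrix.add_mulVec, h1,
    Matrix.one_mulVec, tensor]

lemma moveUpDown_mem_unitaryGroup :
    moveUpDown n ∈ Matrix.unitaryGroup (Fin 2 × Grid n) ℂ :=
  condMove_mem_unitaryGroup (by simp [ketUp, ketDown, dotProduct])
    ketbra_ketUp_add_ketbra_ketDown _ _

lemma moveLeftRight_mem_unitaryGroup :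
    moveLeftRight n ∈ Matrix.unitaryGroup (Fin 2 × Grid n) ℂ :=
  condMove_mem_unitaryGroup (by simp [ketLeft, ketRight, ketUp, ketDown, dotProduct])
    ketbra_ketLeft_add_ketbra_ketRight _ _

lemma walk_mem_unitaryGroup : walk n ∈ Matrix.unitaryGroup (Fin 2 × Grid n) ℂ :=
  mul_mem moveLeftRight_mem_unitaryGroup moveUpDown_mem_unitaryGroup

lemma commute_one_kronecker_shift_walk (v : Grid n) : Commute (1 ⊗ₖ shift n v) (walk n) :=
  (commute_one_kronecker_shift_condMove ..).mul_right (commute_one_kronecker_shift_condMove ..)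

lemma walk_eq : walk n =
    (ketbra ketLeft * ketbra ketUp) ⊗ₖ shift n (-1, -1) +
      (ketbra ketRight * ketbra ketUp) ⊗ₖ shift n (1, -1) +
      (ketbra ketLeft * ketbra ketDown) ⊗ₖ shift n (-1, 1) +
      (ketbra ketRight * ketbra ketDown) ⊗ₖ shift n (1, 1) := by
  simp only [walk, moveLeftRight, moveUpDown, add_mul, mul_add, ← Matrix.mul_kronecker_mul,
    shift_mul_shift, Prod.mk_add_mk, add_zero, zero_add, ← add_assoc]

/-- The sum of the four diagonal translations: four times the diagonal random walk. -/
noncomputable def diagShift (n : ℕ) : Matrix (Grid n) (Grid n) ℂ :=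
  shift n (1, 1) + shift n (1, -1) + shift n (-1, 1) + shift n (-1, -1)

lemma walk_add_conjTranspose : walk n + (walk n)ᴴ = (1 / 2 : ℂ) • (1 ⊗ₖ diagShift n) := by
  have hLU : ketbra ketLeft * ketbra ketUp + ketbra ketDown * ketbra ketRight =
      (1 / 2 : ℂ) • 1 := by
    rw [ketbra_ketLeft, ketbra_ketUp, ketbra_ketDown, ketbra_ketRight, Matrix.one_fin_two]
    simp
  have hLD : ketbra ketLeft * ketbra ketDown + ketbra ketUp * ketbra ketRight =
      (1 / 2 : ℂ) • 1 := by
    rw [ketbra_ketLeft, ketbra_ketUp, ketbra_ketDown, ketbra_ketRight, Matrix.one_fin_two]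
    simp
  have hRU : ketbra ketRight * ketbra ketUp + ketbra ketDown * ketbra ketLeft =
      (1 / 2 : ℂ) • 1 := by
    rw [ketbra_ketLeft, ketbra_ketUp, ketbra_ketDown, ketbra_ketRight, Matrix.one_fin_two]
    simp
  have hRD : ketbra ketRight * ketbra ketDown + ketbra ketUp * ketbra ketLeft =
      (1 / 2 : ℂ) • 1 := by
    rw [ketbra_ketLeft, ketbra_ketUp, ketbra_ketDown, ketbra_ketRight, Matrix.one_fin_two]
    simp
  calc walk n + (walk n)ᴴ =
      (ketbra ketLeft * ketbra ketUp + ketbra ketDown * ketbra ketRight) ⊗ₖ shift n (-1, -1) +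
      (ketbra ketLeft * ketbra ketDown + ketbra ketUp * ketbra ketRight) ⊗ₖ shift n (-1, 1) +
      (ketbra ketRight * ketbra ketUp + ketbra ketDown * ketbra ketLeft) ⊗ₖ shift n (1, -1) +
      (ketbra ketRight * ketbra ketDown + ketbra ketUp * ketbra ketLeft) ⊗ₖ shift n (1, 1) := by
        simp only [walk_eq, Matrix.conjTranspose_add, Matrix.conjTranspose_kronecker,
          Matrix.conjTranspose_mul, conjTranspose_ketbra, conjTranspose_shift, Prod.neg_mk,
          neg_neg, Matrix.add_kronecker]
        abel
    _ = _ := by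
        rw [hLU, hLD, hRU, hRD, diagShift]
        simp only [Matrix.smul_kronecker, Matrix.kronecker_add, smul_add]
        abel

lemma sqNorm_ketSV (v : Grid n) : sqNorm (ketSV n v) = 1 := by
  rw [ketSV_eq_tensor, sqNorm_tensor, sqNorm_ketS, sqNorm_single, one_mul]

lemma sqNorm_originState : sqNorm (originState n) = 1 := by
  rw [originState_eq_tensor, sqNorm_tensor, sqNorm_ketUp, sqNorm_single, one_mul]

lemma uniformState_eq_tensor : uniformState n = tensor ketS fun _ => (n : ℂ)⁻¹ := by
  have hcard : √(Fintype.card (Fin 2 × Grid n) : ℝ) = √2 * n := by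
    rw [Fintype.card_prod, Fintype.card_prod, Fintype.card_fin, ZMod.card]
    push_cast
    rw [Real.sqrt_mul (by norm_num), Real.sqrt_mul_self n.cast_nonneg]
  ext p
  rw [uniformState, hcard, tensor, ketS_eq]
  push_cast
  rw [mul_inv]

lemma sqNorm_uniformState : sqNorm (uniformState n) = 1 := by
  have hn : (n : ℝ) ≠ 0 := Nat.cast_ne_zero.2 (NeZero.ne n)
  rw [uniformState_eq_tensor, sqNorm_tensor, sqNorm_ketS, one_mul]
  simp only [sqNorm, norm_inv, RCLike.norm_natCast, Finset.sum_const, Finset.card_univ,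
    Fintype.card_prod, ZMod.card, nsmul_eq_mul, Nat.cast_mul]
  field_simp

lemma walk_mulVec_uniformState : walk n *ᵥ uniformState n = uniformState n := by
  rw [uniformState_eq_tensor, walk, ← Matrix.mulVec_mulVec, moveUpDown_eq, moveLeftRight_eq,
    condMove_mulVec_tensor_const ketbra_ketUp_add_ketbra_ketDown,
    condMove_mulVec_tensor_const ketbra_ketLeft_add_ketbra_ketRight]

lemma star_ketSV_dotProduct_uniformState (v : Grid n) :
    star (ketSV n v) ⬝ᵥ uniformState n = (n : ℂ)⁻¹ := by
  rw [ketSV_eq_tensor, uniformState_eq_tensor, star_tensor_dotProduct_tensor,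
    star_dotProduct_self, sqNorm_ketS, Pi.star_single, single_dotProduct, star_one]
  simp

lemma star_ketSV_dotProduct_walk_mulVec_tensor (v : Grid n) (f : Grid n → ℂ) :
    star (ketSV n v) ⬝ᵥ (walk n *ᵥ tensor ketS f) =
      (f (v + (1, 1)) + f (v + (1, -1))) / 2 := by
  have hL : ∀ K, star ketS ⬝ᵥ ((ketbra ketLeft * K) *ᵥ ketS) = star ketS ⬝ᵥ (K *ᵥ ketS) := by
    intro K
    rw [← Matrix.mulVec_mulVec, star_dotProduct_mulVec, conjTranspose_ketbra, ketbra_mulVec,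
      show ketLeft = ketS from rfl, star_dotProduct_self, sqNorm_ketS, Complex.ofReal_one,
      one_smul]
  have hR : ∀ K, star ketS ⬝ᵥ ((ketbra ketRight * K) *ᵥ ketS) = 0 := by
    intro K
    have h : star ketRight ⬝ᵥ ketS = 0 := by
      simp [ketRight, ketS, ketUp, ketDown, dotProduct]
    rw [← Matrix.mulVec_mulVec, star_dotProduct_mulVec, conjTranspose_ketbra, ketbra_mulVec, h,
      zero_smul, star_zero, zero_dotProduct]
  have hU : star ketS ⬝ᵥ (ketbra ketUp *ᵥ ketS) = 1 / 2 := by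
    rw [← inv_sqrt_two_mul_self, ketbra_ketUp, ketS_eq]
    simp [dotProduct, Matrix.mulVec]
  have hD : star ketS ⬝ᵥ (ketbra ketDown *ᵥ ketS) = 1 / 2 := by
    rw [← inv_sqrt_two_mul_self, ketbra_ketDown, ketS_eq]
    simp [dotProduct, Matrix.mulVec]
  simp only [walk_eq, Matrix.add_mulVec, dotProduct_add, ketSV_eq_tensor,
    kronecker_mulVec_tensor, star_tensor_dotProduct_tensor, hL, hR, hU, hD, Pi.star_single,
    star_one, single_dotProduct, shift_mulVec_apply, sub_eq_add_neg, Prod.neg_mk, neg_neg]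
  ring

lemma norm_star_ketSV_dotProduct_sq_le (v : Grid n) (ψ : Fin 2 × Grid n → ℂ) :
    ‖star (ketSV n v) ⬝ᵥ ψ‖ ^ 2 ≤ probAt ψ v := by
  have h := norm_star_dotProduct_le ketS fun i => ψ (i, v)
  rw [sqNorm_ketS, Real.sqrt_one, one_mul] at h
  rw [ketSV_eq_tensor, star_tensor_single_dotProduct]
  exact (Real.le_sqrt (norm_nonneg _) (sqNorm_nonneg _)).1 h

lemma walkSuccess_eq_zero_vertex (v : Grid n) (T : ℕ) :
    walkSuccess n v T = walkSuccess n 0 T := by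
  set S := (1 : Matrix (Fin 2) (Fin 2) ℂ) ⊗ₖ shift n v with hS
  have hSu : S *ᵥ uniformState n = uniformState n :=
    funext fun p => one_kronecker_shift_mulVec_apply v _ p.1 p.2
  have hSφ : S *ᵥ ketSV n 0 = ketSV n v := by
    rw [hS, ketSV_eq_tensor, ketSV_eq_tensor, kronecker_mulVec_tensor, Matrix.one_mulVec,
      shift_mulVec_single, zero_add]
  have hSU : S ∈ Matrix.unitaryGroup (Fin 2 × Grid n) ℂ :=
    Matrix.kronecker_mem_unitary (one_mem _) (shift_mem_unitaryGroup v)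
  have hcov := (semiconjBy_searchStep hSU (commute_one_kronecker_shift_walk v)
    (ketSV n 0)).pow_right T
  rw [hSφ] at hcov
  calc walkSuccess n v T
      = probAt ((searchStep (walk n) (ketSV n v) ^ T * S) *ᵥ uniformState n) v := by
        rw [← Matrix.mulVec_mulVec, hSu]; rfl
    _ = probAt (S *ᵥ (markedWalk n 0 ^ T *ᵥ uniformState n)) v := by
        rw [← hcov.eq, ← Matrix.mulVec_mulVec]; rfl
    _ = walkSuccess n 0 T := by
        rw [hS, probAt_one_kronecker_shift, sub_self, walkSuccess]

end Walk

/-! ### The Green function of the diagonal random walk on the grid -/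

section Green

variable {n : ℕ} [NeZero n]

/-- The cosine `cos (2πk/n)`, as the real part of the standard additive character. -/
noncomputable def cosAt (k : ZMod n) : ℝ := (ZMod.stdAddChar k : ℂ).re

lemma stdAddChar_add_stdAddChar_neg (k : ZMod n) :
    (ZMod.stdAddChar k : ℂ) + ZMod.stdAddChar (-k) = 2 * cosAt k := by
  rw [AddChar.map_neg_eq_conj, Complex.add_conj, cosAt]
  push_cast
  rfl

lemma cosAt_neg (k : ZMod n) : cosAt (-k) = cosAt k := by
  rw [cosAt, AddChar.map_neg_eq_conj, Complex.conj_re, cosAt]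

lemma cosAt_intCast (j : ℤ) : cosAt (j : ZMod n) = Real.cos (2 * (Real.pi * j / n)) := by
  rw [cosAt, ZMod.stdAddChar_coe, show 2 * (Real.pi : ℂ) * Complex.I * j / n =
    ((2 * (Real.pi * j / n) : ℝ) : ℂ) * Complex.I by push_cast; ring, Complex.exp_ofReal_mul_I_re]

lemma one_sub_cosAt_sq (k : ZMod n) : 1 - cosAt k ^ 2 = (1 - cosAt (k + k)) / 2 := by
  have hk : cosAt k = Real.cos (2 * (Real.pi * k.valMinAbs / n)) := by
    rw [← cosAt_intCast, ZMod.coe_valMinAbs]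
  have hkk : cosAt (k + k) = Real.cos (2 * (2 * (Real.pi * k.valMinAbs / n))) := by
    rw [← ZMod.coe_valMinAbs k, ← Int.cast_add, cosAt_intCast, ZMod.coe_valMinAbs]
    push_cast
    ring_nf
  rw [hkk, Real.cos_two_mul, hk]
  ring

/-- The plane wave `w ↦ exp (2πi (p₁w₁ + p₂w₂) / n)` on the grid. -/
noncomputable def planeWave (p : Grid n) : Grid n → ℂ :=
  fun w => ZMod.stdAddChar (p.1 * w.1 + p.2 * w.2)

lemma planeWave_add (p v w : Grid n) : planeWave p (v + w) = planeWave p v * planeWave p w := by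
  simp only [planeWave, Prod.fst_add, Prod.snd_add, ← AddChar.map_add_eq_mul]
  congr 1
  ring

lemma planeWave_zero (p : Grid n) : planeWave p 0 = 1 := by
  simp [planeWave]

lemma shift_mulVec_planeWave (g p : Grid n) :
    shift n g *ᵥ planeWave p = planeWave p (-g) • planeWave p := by
  ext w
  rw [shift_mulVec_apply, sub_eq_neg_add, planeWave_add, Pi.smul_apply, smul_eq_mul]

lemma diagShift_mulVec_planeWave (p : Grid n) :
    diagShift n *ᵥ planeWave p = (4 * (cosAt p.1 * cosAt p.2) : ℂ) • planeWave p := by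
  simp only [diagShift, Matrix.add_mulVec, shift_mulVec_planeWave, ← add_smul, Prod.neg_mk,
    neg_neg]
  congr 1
  simp only [planeWave, mul_one, mul_neg, AddChar.map_add_eq_mul]
  linear_combination (ZMod.stdAddChar p.2 + ZMod.stdAddChar (-p.2) : ℂ) *
    stdAddChar_add_stdAddChar_neg p.1 + 2 * cosAt p.1 * stdAddChar_add_stdAddChar_neg p.2

lemma sum_planeWave (w : Grid n) :
    ∑ p : Grid n, planeWave p w = if w = 0 then (n : ℂ) ^ 2 else 0 := by
  have h : ∀ x : ZMod n, ∑ k : ZMod n, (ZMod.stdAddChar (k * x) : ℂ) =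
      if x = 0 then (n : ℂ) else 0 := fun x => by
    rw [AddChar.sum_mulShift x (ZMod.isPrimitive_stdAddChar n), ZMod.card, Nat.cast_ite,
      Nat.cast_zero]
  simp only [planeWave, AddChar.map_add_eq_mul, Fintype.sum_prod_type]
  rw [← Fintype.sum_mul_sum, h, h, ite_zero_mul_ite_zero, ← sq]
  exact if_congr (Prod.ext_iff (y := (0 : Grid n))).symm rfl rfl

/-- The eigenvalue of `(1 - z U) (1 - z Uᴴ)` on the plane wave with wave vector `p`, where `U` is
the walk. -/
noncomputable def symbol (z : ℝ) (p : Grid n) : ℝ := 1 + z ^ 2 - 2 * z * (cosAt p.1 * cosAt p.2)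

/-- The Green function of the diagonal random walk, the solution of `green_equation`. -/
noncomputable def green (n : ℕ) [NeZero n] (z : ℝ) : Grid n → ℂ :=
  ∑ p : Grid n, ((n ^ 2 * symbol z p : ℝ) : ℂ)⁻¹ • planeWave p

lemma green_zero (z : ℝ) :
    green n z 0 = ((∑ p : Grid n, (n ^ 2 * symbol z p)⁻¹ : ℝ) : ℂ) := by
  simp [green, Finset.sum_apply, planeWave_zero]

lemma green_neg (z : ℝ) (w : Grid n) : green n z (-w) = green n z w := by
  simp only [green, Finset.sum_apply, Pi.smul_apply]
  rw [← Equiv.sum_comp (Equiv.neg (Grid n))]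
  simp [symbol, planeWave, cosAt_neg]

lemma green_equation {z : ℝ} (hz : ∀ p : Grid n, symbol z p ≠ 0) :
    (1 + z ^ 2 : ℂ) • green n z - (z / 2 : ℂ) • (diagShift n *ᵥ green n z) = Pi.single 0 1 := by
  have hn : (n : ℂ) ≠ 0 := Nat.cast_ne_zero.2 (NeZero.ne n)
  have hmode : ∀ p : Grid n, (1 + z ^ 2 : ℂ) • ((n ^ 2 * symbol z p : ℝ) : ℂ)⁻¹ • planeWave p -
      (z / 2 : ℂ) • (diagShift n *ᵥ (((n ^ 2 * symbol z p : ℝ) : ℂ)⁻¹ • planeWave p)) =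
      ((n : ℂ) ^ 2)⁻¹ • planeWave p := by
    intro p
    have hs : (symbol z p : ℂ) ≠ 0 := Complex.ofReal_ne_zero.2 (hz p)
    rw [Matrix.mulVec_smul, diagShift_mulVec_planeWave, smul_smul, smul_smul, smul_smul,
      ← sub_smul]
    congr 1
    push_cast
    field_simp
    rw [symbol]
    push_cast
    ring
  rw [green, Matrix.mulVec_sum, Finset.smul_sum, Finset.smul_sum, ← Finset.sum_sub_distrib,
    Finset.sum_congr rfl fun p _ => hmode p, ← Finset.smul_sum]
  ext w
  rw [Pi.smul_apply, Finset.sum_apply, sum_planeWave, Pi.single_apply, smul_ite, smul_zero,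
    smul_eq_mul, inv_mul_cancel₀ (pow_ne_zero 2 hn)]

/-- The distance of `2k` from `0` on the cycle of length `n`. Doubling is needed because
`cos (2πk/n)` is close to `±1` both for `k` near `0` and for `k` near `n/2`. -/
def doubleDist (k : ZMod n) : ℕ := (k + k).valMinAbs.natAbs

lemma doubleDist_lt (k : ZMod n) : doubleDist k < n :=
  (ZMod.natAbs_valMinAbs_le _).trans_lt (Nat.div_lt_self (NeZero.pos n) one_lt_two)

lemma le_one_sub_cosAt_sq (k : ZMod n) :
    4 * (doubleDist k : ℝ) ^ 2 / n ^ 2 ≤ 1 - cosAt k ^ 2 := by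
  have hn : (0 : ℝ) < n := Nat.cast_pos.2 (NeZero.pos n)
  set j := (k + k).valMinAbs with hj
  have habs : |Real.pi * j / n| = Real.pi * doubleDist k / n := by
    rw [abs_div, abs_mul, abs_of_pos Real.pi_pos, Nat.abs_cast, doubleDist, Nat.cast_natAbs,
      Int.cast_abs]
  have hle : |Real.pi * j / n| ≤ Real.pi / 2 := by
    have h2 : (doubleDist k : ℝ) * 2 ≤ n := mod_cast Nat.le_div_iff_mul_le two_pos |>.1
      (ZMod.natAbs_valMinAbs_le (k + k))
    rw [habs, div_le_div_iff₀ hn two_pos, mul_assoc]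
    gcongr
  have hsin := Real.mul_abs_le_abs_sin hle
  calc 4 * (doubleDist k : ℝ) ^ 2 / n ^ 2 = (2 / Real.pi * |Real.pi * j / n|) ^ 2 := by
        rw [habs]
        field_simp
        ring
    _ ≤ |Real.sin (Real.pi * j / n)| ^ 2 := by gcongr
    _ = 1 - cosAt k ^ 2 := by
        rw [sq_abs, Real.sin_sq, Real.cos_sq, ← cosAt_intCast, hj, ZMod.coe_valMinAbs,
          one_sub_cosAt_sq]
        ring

lemma le_symbol {z : ℝ} (hz : 1 / 2 ≤ z) (p : Grid n) :
    (1 - z) ^ 2 + 2 / (n : ℝ) ^ 2 * ((doubleDist p.1 : ℝ) ^ 2 + (doubleDist p.2 : ℝ) ^ 2) ≤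
      symbol z p := by
  have hcos : 2 / (n : ℝ) ^ 2 * ((doubleDist p.1 : ℝ) ^ 2 + (doubleDist p.2 : ℝ) ^ 2) ≤
      1 - cosAt p.1 * cosAt p.2 := by
    have hsum : 2 / (n : ℝ) ^ 2 * ((doubleDist p.1 : ℝ) ^ 2 + (doubleDist p.2 : ℝ) ^ 2) =
      (4 * (doubleDist p.1 : ℝ) ^ 2 / n ^ 2 + 4 * (doubleDist p.2 : ℝ) ^ 2 / n ^ 2) / 2 := by ring
    linarith [le_one_sub_cosAt_sq p.1, le_one_sub_cosAt_sq p.2,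
      two_mul_le_add_sq (cosAt p.1) (cosAt p.2)]
  have h0 : 0 ≤ 1 - cosAt p.1 * cosAt p.2 := le_trans (by positivity) hcos
  rw [symbol]
  linarith [le_mul_of_one_le_left h0 (by linarith : 1 ≤ 2 * z)]

lemma symbol_pos {z : ℝ} (hz : 1 / 2 ≤ z) (hz1 : z < 1) (p : Grid n) : 0 < symbol z p :=
  (add_pos_of_pos_of_nonneg (pow_pos (sub_pos.2 hz1) 2) (by positivity)).trans_le
    (le_symbol hz p)

lemma card_filter_add_self_eq_le (a : ZMod n) :
    (Finset.univ.filter fun k : ZMod n => k + k = a).card ≤ 2 := by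
  have hsub : (Finset.univ.filter fun k : ZMod n => k + k = a) ⊆
      {((a.val / 2 : ℕ) : ZMod n), (((a.val + n) / 2 : ℕ) : ZMod n)} := by
    intro k hk
    have hmod : (k.val + k.val) % n = a.val := by
      rw [← ZMod.val_add, (Finset.mem_filter.1 hk).2]
    have hlt := ZMod.val_lt k
    have hval : k.val = a.val / 2 ∨ k.val = (a.val + n) / 2 := by
      rcases lt_or_ge (k.val + k.val) n with h | h
      · rw [Nat.mod_eq_of_lt h] at hmod
        omega
      · rw [Nat.mod_eq_sub_mod h, Nat.mod_eq_of_lt (by omega)] at hmod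
        omega
    rw [Finset.mem_insert, Finset.mem_singleton, ← ZMod.natCast_zmod_val k]
    exact hval.imp (congrArg _) (congrArg _)
  exact (Finset.card_le_card hsub).trans Finset.card_le_two

lemma card_filter_doubleDist_eq_le (i : ℕ) :
    (Finset.univ.filter fun k : ZMod n => doubleDist k = i).card ≤ 4 := by
  have hsub : (Finset.univ.filter fun k : ZMod n => doubleDist k = i) ⊆
      (Finset.univ.filter fun k : ZMod n => k + k = i) ∪
        Finset.univ.filter fun k : ZMod n => k + k = -i := by
    intro k hk
    have hcast := ZMod.coe_valMinAbs (k + k)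
    rw [Finset.mem_union, Finset.mem_filter_univ, Finset.mem_filter_univ]
    rcases Int.natAbs_eq_iff.1 (Finset.mem_filter_univ k |>.1 hk) with h | h
    · left
      rw [← hcast, h, Int.cast_natCast]
    · right
      rw [← hcast, h, Int.cast_neg, Int.cast_natCast]
  calc _ ≤ _ := Finset.card_le_card hsub
    _ ≤ _ := Finset.card_union_le _ _
    _ ≤ 2 + 2 := add_le_add (card_filter_add_self_eq_le _) (card_filter_add_self_eq_le _)

lemma sum_doubleDist_le {F : ℕ → ℝ} (hF : ∀ i, 0 ≤ F i) :
    ∑ k : ZMod n, F (doubleDist k) ≤ 4 * ∑ i ∈ Finset.range n, F i := by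
  rw [← Finset.sum_fiberwise_of_maps_to (t := Finset.range n) (g := doubleDist)
    fun k _ => Finset.mem_range.2 (doubleDist_lt k), Finset.mul_sum]
  refine Finset.sum_le_sum fun i _ => ?_
  rw [Finset.sum_congr rfl (g := fun _ => F i) fun k hk => by rw [(Finset.mem_filter.1 hk).2],
    Finset.sum_const, nsmul_eq_mul]
  exact mul_le_mul_of_nonneg_right (mod_cast card_filter_doubleDist_eq_le i) (hF i)

lemma sum_grid_doubleDist_le {F : ℕ → ℕ → ℝ} (hF : ∀ i j, 0 ≤ F i j) :
    ∑ p : Grid n, F (doubleDist p.1) (doubleDist p.2) ≤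
      16 * ∑ i ∈ Finset.range n, ∑ j ∈ Finset.range n, F i j := by
  calc ∑ p : Grid n, F (doubleDist p.1) (doubleDist p.2)
      = ∑ k : ZMod n, ∑ l : ZMod n, F (doubleDist k) (doubleDist l) := Fintype.sum_prod_type _
    _ ≤ ∑ k : ZMod n, 4 * ∑ j ∈ Finset.range n, F (doubleDist k) j :=
        Finset.sum_le_sum fun k _ => sum_doubleDist_le (hF _)
    _ ≤ 4 * ∑ i ∈ Finset.range n, 4 * ∑ j ∈ Finset.range n, F i j :=
        sum_doubleDist_le (F := fun i => 4 * ∑ j ∈ Finset.range n, F i j)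
          fun i => mul_nonneg (by norm_num) (Finset.sum_nonneg fun j _ => hF i j)
    _ = 16 * ∑ i ∈ Finset.range n, ∑ j ∈ Finset.range n, F i j := by
        rw [← Finset.mul_sum, ← mul_assoc]
        norm_num

lemma inv_quadratic_le {a c : ℝ} (ha : 0 ≤ a) (hc : 0 < c) {i j m : ℕ} (hm : 0 < m)
    (h : i = m ∨ j = m) :
    (a + c * ((i : ℝ) ^ 2 + (j : ℝ) ^ 2))⁻¹ ≤ (c * (m : ℝ) ^ 2)⁻¹ := by
  have hsq : (m : ℝ) ^ 2 ≤ (i : ℝ) ^ 2 + (j : ℝ) ^ 2 := by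
    rcases h with rfl | rfl
    · exact le_add_of_nonneg_right (sq_nonneg _)
    · exact le_add_of_nonneg_left (sq_nonneg _)
  have : (0 : ℝ) < m := Nat.cast_pos.2 hm
  refine inv_anti₀ (by positivity) ((mul_le_mul_of_nonneg_left hsq hc.le).trans ?_)
  exact le_add_of_nonneg_left ha

lemma sum_inv_quadratic_shell_le {a c : ℝ} (ha : 0 ≤ a) (hc : 0 < c) {m : ℕ} (hm : 0 < m) :
    ∑ i ∈ Finset.range m, (a + c * ((i : ℝ) ^ 2 + (m : ℝ) ^ 2))⁻¹ +
      ∑ j ∈ Finset.range (m + 1), (a + c * ((m : ℝ) ^ 2 + (j : ℝ) ^ 2))⁻¹ ≤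
      3 / c * (m : ℝ)⁻¹ := by
  have hm' : (1 : ℝ) ≤ m := mod_cast hm
  calc _ ≤ ∑ _i ∈ Finset.range m, (c * (m : ℝ) ^ 2)⁻¹ +
          ∑ _j ∈ Finset.range (m + 1), (c * (m : ℝ) ^ 2)⁻¹ :=
        add_le_add (Finset.sum_le_sum fun _ _ => inv_quadratic_le ha hc hm (.inr rfl))
          (Finset.sum_le_sum fun _ _ => inv_quadratic_le ha hc hm (.inl rfl))
    _ = (2 * m + 1) * (c * (m : ℝ) ^ 2)⁻¹ := by
        rw [Finset.sum_const, Finset.sum_const, Finset.card_range, Finset.card_range]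
        simp only [nsmul_eq_mul]
        push_cast
        ring
    _ ≤ (3 * m) * (c * (m : ℝ) ^ 2)⁻¹ := by
        gcongr
        linarith
    _ = 3 / c * (m : ℝ)⁻¹ := by field_simp

lemma sum_inv_quadratic_le {a c : ℝ} (ha : 0 ≤ a) (hc : 0 < c) (m : ℕ) :
    ∑ i ∈ Finset.range (m + 1), ∑ j ∈ Finset.range (m + 1),
      (a + c * ((i : ℝ) ^ 2 + (j : ℝ) ^ 2))⁻¹ ≤ a⁻¹ + 3 / c * (harmonic m : ℝ) := by
  induction m with
  | zero => simp
  | succ m ih =>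
    have hshell := sum_inv_quadratic_shell_le ha hc m.succ_pos
    rw [Finset.sum_range_succ]
    simp_rw [Finset.sum_range_succ _ (m + 1)] at hshell ⊢
    rw [Finset.sum_add_distrib, harmonic_succ]
    push_cast at hshell ⊢
    linarith

lemma sum_inv_symbol_le {z : ℝ} (hz : 1 / 2 ≤ z) (hz1 : z < 1) :
    ∑ p : Grid n, (n ^ 2 * symbol z p)⁻¹ ≤
      16 / (n ^ 2 * (1 - z) ^ 2) + 24 * (harmonic (n - 1) : ℝ) := by
  have hn : (0 : ℝ) < n := Nat.cast_pos.2 (NeZero.pos n)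
  have hz0 : (0 : ℝ) < (1 - z) ^ 2 := pow_pos (sub_pos.2 hz1) 2
  have hrange : Finset.range n = Finset.range (n - 1 + 1) := by
    rw [Nat.sub_add_cancel (NeZero.one_le (n := n))]
  set F : ℕ → ℕ → ℝ := fun i j =>
    ((1 - z) ^ 2 + 2 / (n : ℝ) ^ 2 * ((i : ℝ) ^ 2 + (j : ℝ) ^ 2))⁻¹
  calc ∑ p : Grid n, (n ^ 2 * symbol z p)⁻¹
      = ((n : ℝ) ^ 2)⁻¹ * ∑ p : Grid n, (symbol z p)⁻¹ := by
        simp only [mul_inv, Finset.mul_sum]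
    _ ≤ ((n : ℝ) ^ 2)⁻¹ * ∑ p : Grid n, F (doubleDist p.1) (doubleDist p.2) := by
        gcongr with p
        exact inv_anti₀ (by positivity) (le_symbol hz p)
    _ ≤ ((n : ℝ) ^ 2)⁻¹ * (16 * ∑ i ∈ Finset.range n, ∑ j ∈ Finset.range n, F i j) := by
        gcongr
        exact sum_grid_doubleDist_le fun i j => by positivity
    _ ≤ ((n : ℝ) ^ 2)⁻¹ *
          (16 * (((1 - z) ^ 2)⁻¹ + 3 / (2 / (n : ℝ) ^ 2) * (harmonic (n - 1) : ℝ))) := by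
        rw [hrange]
        gcongr
        exact sum_inv_quadratic_le hz0.le (by positivity) (n - 1)
    _ = 16 / (n ^ 2 * (1 - z) ^ 2) + 24 * (harmonic (n - 1) : ℝ) := by
        field_simp
        ring

end Green

/-! ### The quantum walk search -/

section WalkSearch

variable {n : ℕ} [NeZero n] {z : ℝ}

/-- The vector `(1 - z Uᴴ)⁻¹ |s, 0⟩`, where `U` is the walk, written as
`(1 - z U) (|s⟩ ⊗ green)`. -/
noncomputable def resolventState (n : ℕ) [NeZero n] (z : ℝ) : Fin 2 × Grid n → ℂ :=
  tensor ketS (green n z) - (z : ℂ) • (walk n *ᵥ tensor ketS (green n z))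

lemma resolventState_equation (hz : ∀ p : Grid n, symbol z p ≠ 0) :
    resolventState n z - (z : ℂ) • ((walk n)ᴴ *ᵥ resolventState n z) = ketSV n 0 := by
  set g := tensor ketS (green n z) with hg
  have hcancel : (walk n)ᴴ *ᵥ (walk n *ᵥ g) = g := by
    rw [Matrix.mulVec_mulVec, ← Matrix.star_eq_conjTranspose,
      Matrix.mem_unitaryGroup_iff'.1 walk_mem_unitaryGroup, Matrix.one_mulVec]
  have hsum : walk n *ᵥ g + (walk n)ᴴ *ᵥ g =
      (1 / 2 : ℂ) • tensor ketS (diagShift n *ᵥ green n z) := by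
    rw [← Matrix.add_mulVec, walk_add_conjTranspose, Matrix.smul_mulVec, hg,
      kronecker_mulVec_tensor, Matrix.one_mulVec]
  rw [resolventState, Matrix.mulVec_sub, Matrix.mulVec_smul, hcancel, ketSV_eq_tensor,
    ← green_equation hz]
  ext p
  have hsum' := congrFun hsum p
  simp only [Pi.add_apply, Pi.sub_apply, Pi.smul_apply, smul_eq_mul, tensor, hg] at hsum' ⊢
  linear_combination -(z : ℂ) * hsum'

lemma star_ketSV_dotProduct_resolventState (hz : ∀ p : Grid n, symbol z p ≠ 0) :
    star (ketSV n 0) ⬝ᵥ resolventState n z = ((1 - z ^ 2) * green n z 0 + 1) / 2 := by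
  have h0 := congrFun (green_equation hz) 0
  simp only [diagShift, Matrix.add_mulVec, Pi.sub_apply, Pi.add_apply, Pi.smul_apply, smul_eq_mul,
    shift_mulVec_apply, zero_sub, green_neg, Pi.single_eq_same] at h0
  have h11 : green n z (-1, -1) = green n z (1, 1) := green_neg z (1, 1)
  have h12 : green n z (-1, 1) = green n z (1, -1) := by
    simpa only [Prod.neg_mk, neg_neg] using green_neg z ((1, -1) : Grid n)
  rw [resolventState, dotProduct_sub, dotProduct_smul, star_ketSV_dotProduct_walk_mulVec_tensor,
    ketSV_eq_tensor, star_tensor_dotProduct_tensor, star_dotProduct_self, sqNorm_ketS,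
    Pi.star_single, single_dotProduct, star_one, zero_add, zero_add, smul_eq_mul]
  rw [h11, h12] at h0
  push_cast
  linear_combination (1 / 2 : ℂ) * h0

lemma star_resolventState_dotProduct_ketSV (hz : ∀ p : Grid n, symbol z p ≠ 0) :
    star (resolventState n z) ⬝ᵥ ketSV n 0 =
      (((1 - z ^ 2) * ∑ p : Grid n, (n ^ 2 * symbol z p)⁻¹ + 1) / 2 : ℝ) := by
  rw [Matrix.star_dotProduct, star_ketSV_dotProduct_resolventState hz, green_zero,
    Complex.star_def]
  norm_cast
  exact Complex.conj_ofReal _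

lemma sqNorm_resolventState (hz : ∀ p : Grid n, symbol z p ≠ 0) (hz1 : z ^ 2 ≠ 1) :
    sqNorm (resolventState n z) = ∑ p : Grid n, (n ^ 2 * symbol z p)⁻¹ := by
  have h := resolvent_dual_re walk_mem_unitaryGroup (sqNorm_ketSV 0) (resolventState_equation hz)
  rw [star_resolventState_dotProduct_ketSV hz, Complex.ofReal_re] at h
  exact mul_left_cancel₀ (sub_ne_zero.2 hz1.symm) (by linarith)

lemma one_le_log_sq {x : ℝ} (hx : 2 ≤ x) : 1 ≤ Real.log (x ^ 2) := by
  have h := Real.log_le_log two_pos hx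
  rw [Real.log_pow]
  push_cast
  linarith [Real.log_two_gt_d9]

lemma two_le_sqrt_mul_log {x : ℝ} (hx : 2 ≤ x) : 2 ≤ √(x ^ 2 * Real.log (x ^ 2)) :=
  Real.le_sqrt_of_sq_le (by nlinarith [one_le_log_sq hx])

lemma sqNorm_resolventState_le (hn : 2 ≤ n) :
    sqNorm (resolventState n (1 - (√((n : ℝ) ^ 2 * Real.log ((n : ℝ) ^ 2)))⁻¹)) ≤
      64 * Real.log ((n : ℝ) ^ 2) := by
  have hn' : (2 : ℝ) ≤ n := mod_cast hn
  have hL := one_le_log_sq hn'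
  have hR := two_le_sqrt_mul_log hn'
  have hR2 := Real.sq_sqrt (x := (n : ℝ) ^ 2 * Real.log ((n : ℝ) ^ 2)) (by positivity)
  set R := √((n : ℝ) ^ 2 * Real.log ((n : ℝ) ^ 2))
  have hR0 : 0 < R⁻¹ := by positivity
  have hz : 1 / 2 ≤ 1 - R⁻¹ := by linarith [inv_anti₀ two_pos hR]
  have hharm : (harmonic (n - 1) : ℝ) ≤ 1 + Real.log ((n : ℝ) ^ 2) / 2 := by
    refine (harmonic_le_one_add_log (n - 1)).trans ?_
    rw [Real.log_pow, Nat.cast_two, mul_div_cancel_left₀ _ two_ne_zero]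
    gcongr
    · exact mod_cast Nat.sub_pos_of_lt hn
    · exact Nat.sub_le n 1
  calc sqNorm (resolventState n (1 - R⁻¹))
      = ∑ p : Grid n, (n ^ 2 * symbol (1 - R⁻¹) p)⁻¹ :=
        sqNorm_resolventState (fun p => (symbol_pos hz (by linarith) p).ne') (by nlinarith)
    _ ≤ 16 / (n ^ 2 * (1 - (1 - R⁻¹)) ^ 2) + 24 * (harmonic (n - 1) : ℝ) :=
        sum_inv_symbol_le hz (by linarith)
    _ = 16 * Real.log ((n : ℝ) ^ 2) + 24 * (harmonic (n - 1) : ℝ) := by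
        rw [sub_sub_cancel, inv_pow, hR2]
        field_simp
    _ ≤ 64 * Real.log ((n : ℝ) ^ 2) := by linarith

lemma one_div_sq_div_le_sq {c L x : ℝ} (hc : 0 < c) (hL : 0 < L) (h : √L ≤ c * L * x) :
    (1 / c) ^ 2 / L ≤ x ^ 2 := by
  have hx : 1 / c ≤ √L * x := by
    have hmul : √L * 1 ≤ √L * (c * (√L * x)) := by
      calc √L * 1 ≤ c * L * x := by rwa [mul_one]
        _ = √L * (c * (√L * x)) := by
            linear_combination -c * x * Real.mul_self_sqrt hL.le
    rw [div_le_iff₀' hc]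
    exact le_of_mul_le_mul_left hmul (Real.sqrt_pos.2 hL)
  calc (1 / c) ^ 2 / L ≤ (√L * x) ^ 2 / L := by gcongr
    _ = x ^ 2 := by rw [mul_pow, Real.sq_sqrt hL.le, mul_div_cancel_left₀ _ hL.ne']

lemma searchStep_walk (v : Grid n) : searchStep (walk n) (ketSV n v) = markedWalk n v := rfl

theorem exists_walkSuccess_ge (hn : 2 ≤ n) :
    ∃ T : ℕ, (T : ℝ) ≤ 4 * √((n : ℝ) ^ 2 * Real.log ((n : ℝ) ^ 2)) ∧
      ∀ v : Grid n, (1 / 1024) ^ 2 / Real.log ((n : ℝ) ^ 2) ≤ walkSuccess n v T := by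
  have hR := two_le_sqrt_mul_log (x := n) (mod_cast hn)
  have hB := sqNorm_resolventState_le hn
  have hL : 0 < Real.log ((n : ℝ) ^ 2) := one_pos.trans_le (one_le_log_sq (mod_cast hn))
  set L := Real.log ((n : ℝ) ^ 2)
  have hRn : √((n : ℝ) ^ 2 * L) = n * √L := by
    rw [Real.sqrt_mul (by positivity), Real.sqrt_sq (by positivity)]
  set R := √((n : ℝ) ^ 2 * L)
  have hR0 : 0 < R⁻¹ := by positivity
  have hz : ∀ p : Grid n, symbol (1 - R⁻¹) p ≠ 0 := fun p =>
    (symbol_pos (by linarith [inv_anti₀ two_pos hR]) (by linarith) p).ne'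
  have hδ : R * ‖star (ketSV n 0) ⬝ᵥ uniformState n‖ = √L := by
    have hn0 : (n : ℝ) ≠ 0 := Nat.cast_ne_zero.2 (NeZero.ne n)
    rw [star_ketSV_dotProduct_uniformState, norm_inv, RCLike.norm_natCast, hRn]
    field_simp
  have hb : √(sqNorm (resolventState n (1 - R⁻¹))) ≤
      8 * R * ‖star (ketSV n 0) ⬝ᵥ uniformState n‖ := by
    rw [mul_assoc, hδ, Real.sqrt_le_left (by positivity), mul_pow, Real.sq_sqrt hL.le]
    linarith
  obtain ⟨T, hT, hamp⟩ := exists_amplitude_ge (by linarith) walk_mem_unitaryGroup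
    walk_mulVec_uniformState sqNorm_uniformState (sqNorm_ketSV 0) (resolventState_equation hz)
    (by rw [star_resolventState_dotProduct_ketSV hz, Complex.ofReal_im]) hb
  refine ⟨T, hT, fun v => ?_⟩
  rw [hδ, searchStep_walk] at hamp
  rw [walkSuccess_eq_zero_vertex]
  refine le_trans ?_ (norm_star_ketSV_dotProduct_sq_le 0 _)
  refine one_div_sq_div_le_sq (by norm_num) hL (hamp.trans ?_)
  rw [show (1024 : ℝ) * L = 16 * (64 * L) by ring]
  gcongr

end WalkSearch

/-! ### Sequences of steps of a local algorithm -/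

section Steps

lemma IsZLocal.star {ι V : Type*} {G : SimpleGraph V} {U : Matrix (ι × V) (ι × V) ℂ}
    (hU : IsZLocal G U) : IsZLocal G (star U) := fun i j v w h =>
  (hU j i w v fun h0 => h (by rw [Matrix.star_apply, h0, star_zero])).imp Eq.symm
    SimpleGraph.Adj.symm

lemma isZLocal_reflection {ι V : Type*} [Fintype ι] [Fintype V] [DecidableEq ι] [DecidableEq V]
    (G : SimpleGraph V) {o : ι × V → ℂ} {v₀ : V} (ho : ∀ p, o p ≠ 0 → p.2 = v₀) :
    IsZLocal G (reflection o) := fun _ _ _ _ h =>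
  (eq_or_ne_zero_of_reflection_apply_ne_zero h).elim (fun heq => .inl (Prod.ext_iff.1 heq).2)
    fun hne => .inl ((ho _ hne.1).trans (ho _ hne.2).symm)

variable {ι V : Type} [Fintype ι] [DecidableEq ι] [Fintype V] [DecidableEq V]
  {G : SimpleGraph V}

lemma Step.op_query (a : V → Bool) (U₀ U₁ : Matrix.unitaryGroup ι ℂ) :
    (Step.query U₀ U₁ : Step ι G).op a =
      Matrix.blockDiagonal fun v => if a v then U₁.1 else U₀.1 := by
  ext p q
  rw [Matrix.blockDiagonal_apply]
  by_cases h : p.2 = q.2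
  · cases ha : a q.2 <;> simp [Step.op, h, ha]
  · simp [Step.op, h]

/-- The step that undoes a given step. -/
def Step.inv : Step ι G → Step ι G
  | .query U₀ U₁ => .query (star U₀) (star U₁)
  | .localStep U hU => .localStep (star U) hU.star

lemma Step.op_inv (a : V → Bool) (s : Step ι G) : s.inv.op a = (s.op a)ᴴ := by
  cases s with
  | query U₀ U₁ =>
    rw [Step.inv, Step.op_query, Step.op_query, Matrix.blockDiagonal_conjTranspose]
    congr 1
    ext v : 1
    split_ifs <;> rfl
  | localStep U hU => rfl

lemma Step.op_mem_unitaryGroup (a : V → Bool) (s : Step ι G) :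
    s.op a ∈ Matrix.unitaryGroup (ι × V) ℂ := by
  cases s with
  | query U₀ U₁ =>
    rw [Matrix.mem_unitaryGroup_iff, Matrix.star_eq_conjTranspose, Step.op_query,
      Matrix.blockDiagonal_conjTranspose, ← Matrix.blockDiagonal_mul,
      ← Matrix.blockDiagonal_one]
    congr 1
    ext v : 1
    split_ifs
    · exact Matrix.mem_unitaryGroup_iff.1 U₁.2
    · exact Matrix.mem_unitaryGroup_iff.1 U₀.2
  | localStep U hU => exact U.2

/-- The operator applied by a sequence of steps; the first step of the list is the rightmost
factor of the product. -/
def totalOp (a : V → Bool) (l : List (Step ι G)) : Matrix (ι × V) (ι × V) ℂ :=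
  (l.map (Step.op a)).reverse.prod

lemma totalOp_cons (a : V → Bool) (s : Step ι G) (l : List (Step ι G)) :
    totalOp a (s :: l) = totalOp a l * s.op a := by
  simp [totalOp]

lemma totalOp_singleton (a : V → Bool) (s : Step ι G) : totalOp a [s] = s.op a := by
  simp [totalOp]

lemma totalOp_append (a : V → Bool) (l l' : List (Step ι G)) :
    totalOp a (l ++ l') = totalOp a l' * totalOp a l := by
  simp [totalOp]

lemma totalOp_map_range_mulVec {a : V → Bool} {s : ℕ → Step ι G} {φ : ℕ → ι × V → ℂ} {k : ℕ}
    (h : ∀ j < k, (s j).op a *ᵥ φ j = φ (j + 1)) :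
    totalOp a ((List.range k).map s) *ᵥ φ 0 = φ k := by
  induction k with
  | zero => exact Matrix.one_mulVec _
  | succ k ih =>
    rw [List.range_succ, List.map_append, List.map_singleton, totalOp_append, totalOp_singleton,
      ← Matrix.mulVec_mulVec, ih fun j hj => h j (by omega), h k k.lt_succ_self]

lemma totalOp_flatten_replicate (a : V → Bool) (l : List (Step ι G)) (T : ℕ) :
    totalOp a (List.replicate T l).flatten = totalOp a l ^ T := by
  induction T with
  | zero => rfl
  | succ T ih => rw [List.replicate_succ, List.flatten_cons, totalOp_append, ih, pow_succ]

lemma finalState_eq_totalOp_mulVec (l : List (Step ι G)) (ψ : ι × V → ℂ) (a : V → Bool) :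
    finalState l ψ a = totalOp a l *ᵥ ψ := by
  induction l generalizing ψ with
  | nil => exact (Matrix.one_mulVec ψ).symm
  | cons s l ih => rw [totalOp_cons, ← Matrix.mulVec_mulVec, ← ih, finalState, finalState,
      List.foldl_cons]

lemma totalOp_mem_unitaryGroup (a : V → Bool) (l : List (Step ι G)) :
    totalOp a l ∈ Matrix.unitaryGroup (ι × V) ℂ := by
  refine Submonoid.list_prod_mem _ fun A hA => ?_
  obtain ⟨s, -, rfl⟩ := List.mem_map.1 (List.mem_reverse.1 hA)
  exact s.op_mem_unitaryGroup a

/-- The sequence of steps that undoes a given sequence of steps. -/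
def invSteps (l : List (Step ι G)) : List (Step ι G) := (l.map Step.inv).reverse

lemma totalOp_invSteps (a : V → Bool) (l : List (Step ι G)) :
    totalOp a (invSteps l) = (totalOp a l)ᴴ := by
  simp [totalOp, invSteps, Matrix.conjTranspose_list_prod, Step.op_inv, Function.comp_def]

end Steps

/-! ### Amplitude amplification -/

section Grover

variable {m : Type*} [Fintype m] {S : Set m} {χ : m → ℂ} {θ : ℝ}

lemma star_dotProduct_indicator (S : Set m) (χ : m → ℂ) :
    star χ ⬝ᵥ S.indicator χ = (sqNorm (S.indicator χ) : ℂ) := by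
  classical
  rw [← star_dotProduct_self]
  refine Finset.sum_congr rfl fun i _ => ?_
  by_cases hi : i ∈ S <;> simp [hi]

lemma sqNorm_indicator_add_compl (S : Set m) (χ : m → ℂ) :
    sqNorm (S.indicator χ) + sqNorm (Sᶜ.indicator χ) = sqNorm χ := by
  classical
  simp only [sqNorm, ← Finset.sum_add_distrib]
  refine Finset.sum_congr rfl fun i _ => ?_
  by_cases hi : i ∈ S <;> simp [hi]

lemma sqNorm_smul (c : ℂ) (x : m → ℂ) : sqNorm (c • x) = ‖c‖ ^ 2 * sqNorm x := by
  simp only [sqNorm, Pi.smul_apply, norm_smul, mul_pow, Finset.mul_sum]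

/-- In the plane spanned by the two parts of `χ` on `S` and off `S`, where the part on `S` has norm
`sin θ`, the unit vector at the angle `α` from the part off `S`. -/
noncomputable def planeState (S : Set m) (χ : m → ℂ) (θ α : ℝ) : m → ℂ :=
  ((Real.sin α / Real.sin θ : ℝ) : ℂ) • S.indicator χ +
    ((Real.cos α / Real.cos θ : ℝ) : ℂ) • Sᶜ.indicator χ

lemma planeState_self {m : Type*} (S : Set m) (χ : m → ℂ) (hs : Real.sin θ ≠ 0)
    (hc : Real.cos θ ≠ 0) : planeState S χ θ θ = χ := by
  rw [planeState, div_self hs, div_self hc, Complex.ofReal_one, one_smul, one_smul,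
    Set.indicator_self_add_compl]

lemma sqNorm_indicator_planeState (hθ : sqNorm (S.indicator χ) = Real.sin θ ^ 2)
    (hs : Real.sin θ ≠ 0) (α : ℝ) :
    sqNorm (S.indicator (planeState S χ θ α)) = Real.sin α ^ 2 := by
  have h : S.indicator (planeState S χ θ α) =
      ((Real.sin α / Real.sin θ : ℝ) : ℂ) • S.indicator χ := by
    ext i
    by_cases hi : i ∈ S <;> simp [planeState, hi]
  rw [h, sqNorm_smul, hθ, Complex.norm_real, Real.norm_eq_abs, sq_abs, ← mul_pow,
    div_mul_cancel₀ _ hs]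

variable [DecidableEq m]

/-- The phase oracle of the set `S`: the sign `1` on `S` and the sign `-1` off `S`. -/
noncomputable def phaseOracle (S : Set m) : Matrix m m ℂ :=
  Matrix.diagonal (S.indicator 1 - Sᶜ.indicator 1)

lemma phaseOracle_mulVec (S : Set m) (x : m → ℂ) :
    phaseOracle S *ᵥ x = S.indicator x - Sᶜ.indicator x := by
  ext i
  rw [phaseOracle, Matrix.mulVec_diagonal]
  by_cases hi : i ∈ S <;> simp [hi]

/-- One round of amplitude amplification of the state `χ` towards the set `S`. -/
noncomputable def groverOp (S : Set m) (χ : m → ℂ) : Matrix m m ℂ := reflection χ * phaseOracle S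

lemma groverOp_mulVec_planeState (hχ : sqNorm χ = 1)
    (hθ : sqNorm (S.indicator χ) = Real.sin θ ^ 2) (hs : Real.sin θ ≠ 0) (hc : Real.cos θ ≠ 0)
    (α : ℝ) : groverOp S χ *ᵥ planeState S χ θ α = planeState S χ θ (α + 2 * θ) := by
  have hθ' : sqNorm (Sᶜ.indicator χ) = Real.cos θ ^ 2 := by
    linarith [sqNorm_indicator_add_compl S χ, Real.sin_sq_add_cos_sq θ]
  have horacle : phaseOracle S *ᵥ planeState S χ θ α =
      ((Real.sin α / Real.sin θ : ℝ) : ℂ) • S.indicator χ -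
        ((Real.cos α / Real.cos θ : ℝ) : ℂ) • Sᶜ.indicator χ := by
    rw [phaseOracle_mulVec]
    ext i
    by_cases hi : i ∈ S <;> simp [planeState, hi]
  have hoverlap : star χ ⬝ᵥ (phaseOracle S *ᵥ planeState S χ θ α) =
      ((-Real.cos (α + θ) : ℝ) : ℂ) := by
    rw [horacle, dotProduct_sub, dotProduct_smul, dotProduct_smul, star_dotProduct_indicator,
      star_dotProduct_indicator, hθ, hθ', smul_eq_mul, smul_eq_mul, Real.cos_add]
    norm_cast
    field_simp
    ring
  have hsin : Real.sin α / Real.sin θ + 2 * Real.cos (α + θ) =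
      Real.sin (α + 2 * θ) / Real.sin θ := by
    rw [eq_div_iff hs, add_mul, div_mul_cancel₀ _ hs, two_mul θ, ← add_assoc,
      Real.sin_add (α + θ), ← add_sub_cancel_right α θ, Real.sin_sub, add_sub_cancel_right]
    ring
  have hcos : 2 * Real.cos (α + θ) - Real.cos α / Real.cos θ =
      Real.cos (α + 2 * θ) / Real.cos θ := by
    rw [eq_div_iff hc, sub_mul, div_mul_cancel₀ _ hc, two_mul θ, ← add_assoc,
      Real.cos_add (α + θ), ← add_sub_cancel_right α θ, Real.cos_sub, add_sub_cancel_right]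
    ring
  rw [groverOp, ← Matrix.mulVec_mulVec, reflection_of_sqNorm_eq_one hχ, Matrix.sub_mulVec,
    Matrix.one_mulVec, Matrix.smul_mulVec, ketbra_mulVec, hoverlap, horacle, planeState, ← hsin,
    ← hcos]
  linear_combination (norm := (push_cast; module))
    (-2 * (Real.cos (α + θ) : ℂ)) • Set.indicator_self_add_compl S χ

lemma sqNorm_indicator_groverOp_pow (hχ : sqNorm χ = 1)
    (hθ : sqNorm (S.indicator χ) = Real.sin θ ^ 2) (hs : Real.sin θ ≠ 0) (hc : Real.cos θ ≠ 0)
    (k : ℕ) :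
    sqNorm (S.indicator (groverOp S χ ^ k *ᵥ χ)) = Real.sin ((2 * k + 1) * θ) ^ 2 := by
  have hpow : groverOp S χ ^ k *ᵥ χ = planeState S χ θ ((2 * k + 1) * θ) := by
    induction k with
    | zero => simp [planeState_self S χ hs hc]
    | succ k ih =>
      rw [pow_succ', ← Matrix.mulVec_mulVec, ih, groverOp_mulVec_planeState hχ hθ hs hc]
      push_cast
      ring_nf
  rw [hpow, sqNorm_indicator_planeState hθ hs]

lemma exists_sin_odd_mul_sq_ge (h0 : 0 < θ) (h1 : θ ≤ Real.pi / 4) :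
    ∃ k : ℕ, k * θ ≤ 1 ∧ 1 / 2 ≤ Real.sin ((2 * k + 1) * θ) ^ 2 := by
  set k := ⌊Real.pi / (4 * θ)⌋₊
  have hle : k * (4 * θ) ≤ Real.pi := by
    rw [← le_div_iff₀ (by positivity)]
    exact Nat.floor_le (by positivity)
  have hlt : Real.pi < (k + 1) * (4 * θ) := by
    rw [← div_lt_iff₀ (by positivity)]
    exact Nat.lt_floor_add_one _
  have hdist : |Real.pi / 2 - (2 * k + 1) * θ| ≤ Real.pi / 4 :=
    (abs_le.2 ⟨by linarith, by linarith⟩).trans h1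
  have hsin : √2 / 2 ≤ Real.sin ((2 * k + 1) * θ) := by
    rw [← Real.cos_pi_div_four, ← Real.cos_pi_div_two_sub, ← Real.cos_abs (Real.pi / 2 - _)]
    exact Real.cos_le_cos_of_nonneg_of_le_pi (abs_nonneg _) (by linarith [Real.pi_pos]) hdist
  refine ⟨k, by linarith [Real.pi_le_four], ?_⟩
  calc (1 / 2 : ℝ) = (√2 / 2) ^ 2 := by
        rw [div_pow, Real.sq_sqrt two_pos.le]
        norm_num
    _ ≤ Real.sin ((2 * k + 1) * θ) ^ 2 := by gcongr

theorem exists_sqNorm_indicator_groverOp_pow_ge (m : Type*) [Fintype m] [DecidableEq m] {p : ℝ}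
    (hp : 0 < p) :
    ∃ k : ℕ, k ≤ (√p)⁻¹ ∧ ∀ (S : Set m) (χ : m → ℂ), sqNorm χ = 1 →
      sqNorm (S.indicator χ) = p → 1 / 2 ≤ sqNorm (S.indicator (groverOp S χ ^ k *ᵥ χ)) := by
  rcases le_or_gt (1 / 2) p with hp2 | hp2
  · refine ⟨0, by simp, fun S χ _ hS => ?_⟩
    rwa [pow_zero, Matrix.one_mulVec, hS]
  have hs : 0 < √p := Real.sqrt_pos.2 hp
  have hsq : √p ≤ √2 / 2 := by
    rw [Real.sqrt_le_left (by positivity), div_pow, Real.sq_sqrt two_pos.le]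
    linarith
  have hsqrt1 : √p ≤ 1 := Real.sqrt_le_one.2 (by linarith)
  set θ := Real.arcsin √p
  have hsin : Real.sin θ = √p := Real.sin_arcsin (by linarith) hsqrt1
  have hθ0 : 0 < θ := Real.arcsin_pos.2 hs
  have hθ1 : θ ≤ Real.pi / 4 := by
    rw [Real.arcsin_le_iff_le_sin' ⟨by linarith [Real.pi_pos], by linarith [Real.pi_pos]⟩,
      Real.sin_pi_div_four]
    exact hsq
  have hcos : 0 < Real.cos θ :=
    Real.cos_pos_of_mem_Ioo ⟨by linarith [Real.pi_pos], by linarith [Real.pi_pos]⟩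
  obtain ⟨k, hk, hbig⟩ := exists_sin_odd_mul_sq_ge hθ0 hθ1
  refine ⟨k, ?_, fun S χ hχ hS => ?_⟩
  · rw [← one_div, le_div_iff₀ hs]
    calc k * √p ≤ k * θ := by
          gcongr
          exact hsin ▸ Real.sin_le hθ0.le
      _ ≤ 1 := hk
  · have hθ : sqNorm (S.indicator χ) = Real.sin θ ^ 2 := by rw [hS, hsin, Real.sq_sqrt hp.le]
    rwa [sqNorm_indicator_groverOp_pow hχ hθ (hsin ▸ hs.ne') hcos.ne']

end Grover

section Amplify

variable {ι V : Type} [Fintype ι] [DecidableEq ι] [Fintype V] [DecidableEq V]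
  {G : SimpleGraph V}

/-- The basis states located at a marked vertex. -/
def markedSet (ι : Type) {V : Type} (a : V → Bool) : Set (ι × V) := {p | a p.2}

lemma algorithmSuccess_eq (l : List (Step ι G)) (ψ : ι × V → ℂ) (a : V → Bool) :
    algorithmSuccess l ψ a = sqNorm ((markedSet ι a).indicator (totalOp a l *ᵥ ψ)) := by
  classical
  rw [algorithmSuccess, finalState_eq_totalOp_mulVec, sqNorm, Fintype.sum_prod_type_right]
  refine Finset.sum_congr rfl fun v _ => ?_
  cases h : a v <;> simp [markedSet, probAt, h]

/-- The query that implements the phase oracle of the marked set. -/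
def oracleQuery : Step ι G := .query (-1) 1

lemma op_oracleQuery (a : V → Bool) :
    (oracleQuery : Step ι G).op a = phaseOracle (markedSet ι a) := by
  have hneg : ((-1 : Matrix.unitaryGroup ι ℂ) : Matrix ι ι ℂ) = -1 := rfl
  ext p q
  rw [oracleQuery, Step.op_query, Matrix.blockDiagonal_apply, phaseOracle, Matrix.diagonal_apply]
  by_cases hpq : p = q
  · subst hpq
    cases ha : a p.2 <;> simp [markedSet, ha, hneg]
  · by_cases h2 : p.2 = q.2
    · have h1 : p.1 ≠ q.1 := fun h => hpq (Prod.ext h h2)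
      cases ha : a p.2 <;> simp [← h2, hneg, hpq, h1]
    · simp [h2, hpq]

/-- The algorithm `l` followed by `k` rounds of amplitude amplification, where `r` is a step that
reflects about the starting state of `l`. -/
def amplify (l : List (Step ι G)) (r : Step ι G) (k : ℕ) : List (Step ι G) :=
  l ++ (List.replicate k (oracleQuery :: (invSteps l ++ r :: l))).flatten

lemma length_amplify (l : List (Step ι G)) (r : Step ι G) (k : ℕ) :
    (amplify l r k).length = l.length + k * (2 * (l.length + 1)) := by
  simp only [amplify, invSteps, List.length_append, List.length_flatten, List.map_replicate,
    List.sum_replicate, List.length_cons, List.length_reverse, List.length_map, smul_eq_mul]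
  ring

lemma totalOp_amplify (a : V → Bool) (l : List (Step ι G)) {r : Step ι G} {o : ι × V → ℂ}
    (hr : r.op a = reflection o) (k : ℕ) :
    totalOp a (amplify l r k) *ᵥ o =
      groverOp (markedSet ι a) (totalOp a l *ᵥ o) ^ k *ᵥ (totalOp a l *ᵥ o) := by
  have hA := totalOp_mem_unitaryGroup a l
  have hround : totalOp a (oracleQuery :: (invSteps l ++ r :: l)) =
      groverOp (markedSet ι a) (totalOp a l *ᵥ o) := by
    rw [totalOp_cons, totalOp_append, totalOp_cons, totalOp_invSteps, op_oracleQuery, hr, groverOp,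
      ← reflection_mulVec_mul hA, Matrix.mul_assoc (reflection _), ← Matrix.star_eq_conjTranspose,
      Matrix.mem_unitaryGroup_iff.1 hA, Matrix.mul_one]
  rw [amplify, totalOp_append, totalOp_flatten_replicate, hround, ← Matrix.mulVec_mulVec]

theorem exists_algorithmSuccess_amplify_ge {p : ℝ} (hp : 0 < p) (l : List (Step ι G))
    {r : Step ι G} {o : ι × V → ℂ} (ho : sqNorm o = 1) (hr : ∀ a, r.op a = reflection o) :
    ∃ k : ℕ, k ≤ (√p)⁻¹ ∧ ∀ a : V → Bool, algorithmSuccess l o a = p →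
      1 / 2 ≤ algorithmSuccess (amplify l r k) o a := by
  obtain ⟨k, hk, hbig⟩ := exists_sqNorm_indicator_groverOp_pow_ge (ι × V) hp
  refine ⟨k, hk, fun a ha => ?_⟩
  rw [algorithmSuccess_eq, totalOp_amplify a l (hr a)]
  exact hbig _ _ ((sqNorm_mulVec (totalOp_mem_unitaryGroup a l) o).trans ho)
    (algorithmSuccess_eq l o a ▸ ha)

end Amplify

/-! ### Preparation of the uniform superposition -/

section GridLocality

variable {n : ℕ}

lemma eq_or_adj_of_sub_mem {v w : Grid n}
    (h : w - v ∈ ({(1, 0), (0, 1)} : Set (Grid n)) ∨ v - w ∈ ({(1, 0), (0, 1)} : Set (Grid n))) :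
    w = v ∨ (gridGraph n).Adj v w := by
  rw [or_iff_not_imp_left, gridGraph, SimpleGraph.circulantGraph_adj]
  exact fun hne => ⟨Ne.symm hne, h.symm⟩

/-- The cycle version of `IsZLocal`: the operator moves every basis state of a cycle by at most one
step. -/
def IsCycleLocal (A : Matrix (ZMod n) (ZMod n) ℂ) : Prop :=
  ∀ x y, A x y ≠ 0 → x = y ∨ x - y = 1 ∨ y - x = 1

variable {ι : Type*} [DecidableEq ι] {A : Matrix (ZMod n) (ZMod n) ℂ}

lemma IsCycleLocal.isZLocal_fst (hA : IsCycleLocal A) :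
    IsZLocal (gridGraph n) ((1 : Matrix ι ι ℂ) ⊗ₖ (A ⊗ₖ (1 : Matrix (ZMod n) (ZMod n) ℂ))) := by
  intro i j v w h
  obtain ⟨h1, h2⟩ := mul_ne_zero_iff.1 (right_ne_zero_of_mul h)
  have hsnd : w.2 = v.2 := by_contra fun hne => h2 (Matrix.one_apply_ne hne)
  rcases hA _ _ h1 with h | h | h
  · exact .inl (Prod.ext h hsnd)
  · exact eq_or_adj_of_sub_mem (.inl (.inl (Prod.ext h (sub_eq_zero.2 hsnd))))
  · exact eq_or_adj_of_sub_mem (.inr (.inl (Prod.ext h (sub_eq_zero.2 hsnd.symm))))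

lemma IsCycleLocal.isZLocal_snd (hA : IsCycleLocal A) :
    IsZLocal (gridGraph n) ((1 : Matrix ι ι ℂ) ⊗ₖ ((1 : Matrix (ZMod n) (ZMod n) ℂ) ⊗ₖ A)) := by
  intro i j v w h
  obtain ⟨h1, h2⟩ := mul_ne_zero_iff.1 (right_ne_zero_of_mul h)
  have hfst : w.1 = v.1 := by_contra fun hne => h1 (Matrix.one_apply_ne hne)
  rcases hA _ _ h2 with h | h | h
  · exact .inl (Prod.ext hfst h)
  · exact eq_or_adj_of_sub_mem (.inl (.inr (Prod.ext (sub_eq_zero.2 hfst) h)))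
  · exact eq_or_adj_of_sub_mem (.inr (.inr (Prod.ext (sub_eq_zero.2 hfst.symm) h)))

end GridLocality

section Ramp

/-- The state on the cycle that is uniform on the first `k` vertices, with the remaining
amplitude at the vertex `k`. -/
noncomputable def ramp (n k : ℕ) : ZMod n → ℂ := fun x =>
  ((if x.val < k then (√n)⁻¹ else if x.val = k then √(1 - k / n) else 0 : ℝ) : ℂ)

lemma star_ramp (n k : ℕ) : star (ramp n k) = ramp n k :=
  funext fun _ => Complex.conj_ofReal _

lemma ramp_zero (n : ℕ) : ramp n 0 = Pi.single 0 1 := by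
  ext x
  by_cases h : x = 0 <;> simp [ramp, ZMod.val_eq_zero, h]

lemma val_mem_of_ramp_ne {n k : ℕ} {x : ZMod n} (h : (ramp n k - ramp n (k + 1)) x ≠ 0) :
    x.val = k ∨ x.val = k + 1 := by
  contrapose! h
  have : x.val < k + 1 ↔ x.val < k := by omega
  simp [ramp, h.1, h.2, this]

variable {n : ℕ} [NeZero n] {k : ℕ}

lemma ramp_last (n : ℕ) [NeZero n] : ramp n (n - 1) = fun _ => (((√n)⁻¹ : ℝ) : ℂ) := by
  ext x
  have hn : 0 < n := NeZero.pos n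
  have hx := ZMod.val_lt x
  have hlast : √(1 - ((n - 1 : ℕ) : ℝ) / n) = (√n)⁻¹ := by
    rw [← Real.sqrt_inv, Nat.cast_pred hn, sub_div, div_self (by positivity), sub_sub_cancel,
      one_div]
  rw [ramp, hlast]
  split_ifs with h1 h2
  · rfl
  · rfl
  · omega

lemma sum_zmod_val {M : Type*} [AddCommMonoid M] (f : ℕ → M) :
    ∑ x : ZMod n, f x.val = ∑ i ∈ Finset.range n, f i :=
  Finset.sum_bij (fun x _ => x.val) (fun x _ => Finset.mem_range.2 (ZMod.val_lt x))
    (fun _ _ _ _ h => ZMod.val_injective n h)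
    (fun i hi => ⟨(i : ZMod n), Finset.mem_univ _, ZMod.val_cast_of_lt (Finset.mem_range.1 hi)⟩)
    fun _ _ => rfl

lemma sqNorm_ramp (hk : k < n) : sqNorm (ramp n k) = 1 := by
  have hn : (0 : ℝ) < n := mod_cast NeZero.pos n
  have hkn : (k : ℝ) / n ≤ 1 := (div_le_one hn).2 (mod_cast hk.le)
  have hentry (x : ZMod n) : ‖ramp n k x‖ ^ 2 =
      (if x.val < k then (n : ℝ)⁻¹ else 0) + if x.val = k then 1 - (k : ℝ) / n else 0 := by
    rw [ramp, Complex.norm_real, Real.norm_eq_abs, sq_abs]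
    rcases lt_trichotomy x.val k with h | h | h
    · simp [h, h.ne, Real.sq_sqrt hn.le]
    · simp [h, Real.sq_sqrt (sub_nonneg.2 hkn)]
    · simp [h.not_gt, h.ne']
  have hfilter : (Finset.range n).filter (· < k) = Finset.range k := by
    ext i
    simp only [Finset.mem_filter, Finset.mem_range]
    omega
  calc sqNorm (ramp n k)
      = ∑ i ∈ Finset.range n,
          ((if i < k then (n : ℝ)⁻¹ else 0) + if i = k then 1 - (k : ℝ) / n else 0) := by
        rw [sqNorm, Finset.sum_congr rfl fun x _ => hentry x, ← sum_zmod_val]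
    _ = k * (n : ℝ)⁻¹ + (1 - k / n) := by
        rw [Finset.sum_add_distrib, Finset.sum_ite_eq', if_pos (Finset.mem_range.2 hk),
          ← Finset.sum_filter, hfilter, Finset.sum_const, Finset.card_range, nsmul_eq_mul]
    _ = 1 := by ring

/-- The reflection that extends the uniform part of the ramp by one vertex. -/
noncomputable def rampUnitary (n : ℕ) [NeZero n] (k : ℕ) : Matrix.unitaryGroup (ZMod n) ℂ :=
  ⟨reflection (ramp n k - ramp n (k + 1)), reflection_mem_unitaryGroup _⟩

lemma rampUnitary_mulVec (hk : k + 1 < n) :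
    (rampUnitary n k).1 *ᵥ ramp n k = ramp n (k + 1) :=
  reflection_sub_mulVec ((sqNorm_ramp (by omega)).trans (sqNorm_ramp hk).symm) (by
    rw [star_ramp, star_ramp, dotProduct_comm])

lemma isCycleLocal_rampUnitary (n k : ℕ) [NeZero n] : IsCycleLocal (rampUnitary n k).1 := by
  intro x y h
  rcases eq_or_ne_zero_of_reflection_apply_ne_zero h with h | ⟨hx, hy⟩
  · exact .inl h
  rw [← ZMod.natCast_zmod_val x, ← ZMod.natCast_zmod_val y]
  rcases val_mem_of_ramp_ne hx with hx | hx <;> rcases val_mem_of_ramp_ne hy with hy | hy <;>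
    simp [hx, hy]

end Ramp

section Preparation

variable {n : ℕ} [NeZero n] {k : ℕ}

/-- The query, independent of the input, that rotates the coin from `⇑` to `s`. -/
noncomputable def coinStep (n : ℕ) [NeZero n] : Step (Fin 2) (gridGraph n) :=
  .query ⟨reflection (ketUp - ketS), reflection_mem_unitaryGroup _⟩
    ⟨reflection (ketUp - ketS), reflection_mem_unitaryGroup _⟩

/-- The local step that extends the ramp in the horizontal direction. -/
noncomputable def rampStepX (n : ℕ) [NeZero n] (k : ℕ) : Step (Fin 2) (gridGraph n) :=
  .localStep ⟨1 ⊗ₖ ((rampUnitary n k).1 ⊗ₖ 1), Matrix.kronecker_mem_unitary (one_mem _)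
    (Matrix.kronecker_mem_unitary (rampUnitary n k).2 (one_mem _))⟩
    (isCycleLocal_rampUnitary n k).isZLocal_fst

/-- The local step that extends the ramp in the vertical direction. -/
noncomputable def rampStepY (n : ℕ) [NeZero n] (k : ℕ) : Step (Fin 2) (gridGraph n) :=
  .localStep ⟨1 ⊗ₖ (1 ⊗ₖ (rampUnitary n k).1), Matrix.kronecker_mem_unitary (one_mem _)
    (Matrix.kronecker_mem_unitary (one_mem _) (rampUnitary n k).2)⟩
    (isCycleLocal_rampUnitary n k).isZLocal_snd

lemma op_coinStep_mulVec (a : Grid n → Bool) (f : Grid n → ℂ) :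
    (coinStep n).op a *ᵥ tensor ketUp f = tensor ketS f := by
  have hsymm : star ketUp ⬝ᵥ ketS = star ketS ⬝ᵥ ketUp := by
    simp [ketS_eq, ketUp, dotProduct]
  rw [coinStep, Step.op_query]
  simp only [ite_self]
  rw [← Matrix.kronecker_one, kronecker_mulVec_tensor, Matrix.one_mulVec,
    reflection_sub_mulVec (sqNorm_ketUp.trans sqNorm_ketS.symm) hsymm]

lemma op_rampStepX_mulVec (hk : k + 1 < n) (a : Grid n → Bool) (c : Fin 2 → ℂ) (f : ZMod n → ℂ) :
    (rampStepX n k).op a *ᵥ tensor c (tensor (ramp n k) f) =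
      tensor c (tensor (ramp n (k + 1)) f) := by
  rw [rampStepX, Step.op, kronecker_mulVec_tensor, kronecker_mulVec_tensor, Matrix.one_mulVec,
    Matrix.one_mulVec, rampUnitary_mulVec hk]

lemma op_rampStepY_mulVec (hk : k + 1 < n) (a : Grid n → Bool) (c : Fin 2 → ℂ) (f : ZMod n → ℂ) :
    (rampStepY n k).op a *ᵥ tensor c (tensor f (ramp n k)) =
      tensor c (tensor f (ramp n (k + 1))) := by
  rw [rampStepY, Step.op, kronecker_mulVec_tensor, kronecker_mulVec_tensor, Matrix.one_mulVec,
    Matrix.one_mulVec, rampUnitary_mulVec hk]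

/-- The steps that turn the state `|⇑⟩|0, 0⟩` into the uniform superposition. -/
noncomputable def prepSteps (n : ℕ) [NeZero n] : List (Step (Fin 2) (gridGraph n)) :=
  coinStep n :: ((List.range (n - 1)).map (rampStepX n) ++ (List.range (n - 1)).map (rampStepY n))

lemma length_prepSteps (n : ℕ) [NeZero n] : (prepSteps n).length = 2 * (n - 1) + 1 := by
  simp only [prepSteps, List.length_cons, List.length_append, List.length_map, List.length_range]
  omega

lemma originState_eq_tensor_ramp (n : ℕ) :
    originState n = tensor ketUp (tensor (ramp n 0) (ramp n 0)) := by
  rw [originState_eq_tensor, ramp_zero]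
  ext ⟨i, x, y⟩
  by_cases hx : x = 0 <;> by_cases hy : y = 0 <;>
    simp [tensor, Pi.single_apply, Prod.ext_iff, hx, hy]

lemma uniformState_eq_tensor_ramp (n : ℕ) [NeZero n] :
    uniformState n = tensor ketS (tensor (ramp n (n - 1)) (ramp n (n - 1))) := by
  rw [uniformState_eq_tensor, ramp_last]
  congr 1
  ext p
  rw [tensor, ← Complex.ofReal_mul, ← mul_inv, Real.mul_self_sqrt n.cast_nonneg,
    Complex.ofReal_inv, Complex.ofReal_natCast]

lemma totalOp_prepSteps_mulVec (a : Grid n → Bool) :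
    totalOp a (prepSteps n) *ᵥ originState n = uniformState n := by
  rw [prepSteps, totalOp_cons, totalOp_append, originState_eq_tensor_ramp,
    ← Matrix.mulVec_mulVec, op_coinStep_mulVec, ← Matrix.mulVec_mulVec,
    totalOp_map_range_mulVec (φ := fun k => tensor ketS (tensor (ramp n k) (ramp n 0)))
      fun j hj => op_rampStepX_mulVec (by omega) a _ _,
    totalOp_map_range_mulVec (φ := fun k => tensor ketS (tensor (ramp n (n - 1)) (ramp n k)))
      fun j hj => op_rampStepY_mulVec (by omega) a _ _, uniformState_eq_tensor_ramp]

end Preparation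

/-! ### The walk as a local algorithm -/

section LocalWalk

variable {n : ℕ}

lemma condMove_apply_ne_zero {ι : Type*} {a b : ι → ℂ} {g h : Grid n} {i j : ι} {v w : Grid n}
    (hne : condMove n a b g h (j, w) (i, v) ≠ 0) : w = v + g ∨ w = v + h := by
  contrapose! hne
  simp [condMove, shift, hne.1, hne.2]

lemma isZLocal_moveUpDown (n : ℕ) : IsZLocal (gridGraph n) (moveUpDown n) := by
  intro i j v w h
  rcases condMove_apply_ne_zero h with rfl | rfl <;> exact eq_or_adj_of_sub_mem (by simp)

lemma isZLocal_moveLeftRight (n : ℕ) : IsZLocal (gridGraph n) (moveLeftRight n) := by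
  intro i j v w h
  rcases condMove_apply_ne_zero h with rfl | rfl <;> exact eq_or_adj_of_sub_mem (by simp)

variable [NeZero n]

/-- The query that reflects the coin in the hyperplane orthogonal to `s` at the marked vertices. -/
noncomputable def coinReflection (n : ℕ) [NeZero n] : Step (Fin 2) (gridGraph n) :=
  .query 1 ⟨reflection ketS, reflection_mem_unitaryGroup _⟩

lemma op_coinReflection (v : Grid n) :
    (coinReflection n).op (fun w => decide (w = v)) = 1 - (2 : ℂ) • ketbra (ketSV n v) := by
  ext ⟨i, w⟩ ⟨j, w'⟩
  rw [coinReflection, Step.op_query, Matrix.blockDiagonal_apply]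
  simp only [reflection_of_sqNorm_eq_one sqNorm_ketS, Matrix.sub_apply, Matrix.smul_apply,
    ketbra, Matrix.vecMulVec_apply, Pi.star_apply, ketSV, Matrix.one_apply, Prod.mk.injEq,
    smul_eq_mul]
  rcases eq_or_ne w w' with rfl | hw
  · by_cases hv : w = v <;> simp [hv, Matrix.one_apply, Matrix.vecMulVec_apply]
  · rcases eq_or_ne w v with rfl | hv
    · simp [hw, hw.symm]
    · simp [hw, hv]

/-- The three steps that carry out one step of the marked walk. -/
noncomputable def walkRound (n : ℕ) [NeZero n] : List (Step (Fin 2) (gridGraph n)) :=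
  [coinReflection n, .localStep ⟨moveUpDown n, moveUpDown_mem_unitaryGroup⟩ (isZLocal_moveUpDown n),
    .localStep ⟨moveLeftRight n, moveLeftRight_mem_unitaryGroup⟩ (isZLocal_moveLeftRight n)]

lemma totalOp_walkRound (v : Grid n) :
    totalOp (fun w => decide (w = v)) (walkRound n) = markedWalk n v := by
  rw [walkRound, totalOp_cons, totalOp_cons, totalOp_singleton, op_coinReflection]
  rfl

/-- The search by `T` steps of the quantum walk, as a local algorithm. -/
noncomputable def walkSteps (n : ℕ) [NeZero n] (T : ℕ) : List (Step (Fin 2) (gridGraph n)) :=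
  prepSteps n ++ (List.replicate T (walkRound n)).flatten

lemma length_walkSteps (n : ℕ) [NeZero n] (T : ℕ) :
    (walkSteps n T).length + 1 = 2 * n + 3 * T := by
  have hn : 0 < n := NeZero.pos n
  simp only [walkSteps, walkRound, List.length_append, length_prepSteps, List.length_flatten,
    List.map_replicate, List.sum_replicate, List.length_cons, List.length_nil, smul_eq_mul]
  omega

lemma algorithmSuccess_walkSteps (v : Grid n) (T : ℕ) :
    algorithmSuccess (walkSteps n T) (originState n) (fun w => decide (w = v)) =
      walkSuccess n v T := by
  rw [algorithmSuccess, finalState_eq_totalOp_mulVec, walkSteps, totalOp_append,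
    totalOp_flatten_replicate, totalOp_walkRound, ← Matrix.mulVec_mulVec, totalOp_prepSteps_mulVec]
  simp [walkSuccess]

/-- The local step that reflects about the starting state `|⇑⟩|0, 0⟩`. -/
noncomputable def originReflection (n : ℕ) [NeZero n] : Step (Fin 2) (gridGraph n) :=
  .localStep ⟨reflection (originState n), reflection_mem_unitaryGroup _⟩
    (isZLocal_reflection _ (v₀ := (0, 0)) fun _ h => of_not_not fun hne => h (if_neg hne))

lemma length_amplify_walkSteps_le (hn : 2 ≤ n) {T k : ℕ}
    (hT : (T : ℝ) ≤ 4 * √((n : ℝ) ^ 2 * Real.log ((n : ℝ) ^ 2)))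
    (hk : (k : ℝ) ≤ 1024 * √(Real.log ((n : ℝ) ^ 2))) (r : Step (Fin 2) (gridGraph n)) :
    ((amplify (walkSteps n T) r k).length : ℝ) ≤ 28686 * (n * Real.log ((n : ℝ) ^ 2)) := by
  have hL1 : 1 ≤ Real.log ((n : ℝ) ^ 2) := one_le_log_sq (mod_cast hn)
  rw [Real.sqrt_mul (by positivity), Real.sqrt_sq n.cast_nonneg] at hT
  set L := Real.log ((n : ℝ) ^ 2)
  have hL : √L * √L = L := Real.mul_self_sqrt (by linarith)
  have hsqrt : 1 ≤ √L := Real.one_le_sqrt.2 hL1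
  have hlen : ((walkSteps n T).length : ℝ) + 1 ≤ 14 * (n * √L) := by
    have h : ((walkSteps n T).length : ℝ) + 1 = 2 * n + 3 * T := mod_cast length_walkSteps n T
    have : n * 1 ≤ n * √L := by gcongr
    linarith
  calc ((amplify (walkSteps n T) r k).length : ℝ)
      = (walkSteps n T).length + k * (2 * ((walkSteps n T).length + 1)) := by
        rw [length_amplify]
        push_cast
        rfl
    _ ≤ 14 * (n * √L) * √L + 1024 * √L * (2 * (14 * (n * √L))) := by
        gcongr
        calc ((walkSteps n T).length : ℝ) ≤ 14 * (n * √L) * 1 := by linarith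
          _ ≤ 14 * (n * √L) * √L := by gcongr
    _ = 28686 * (n * L) := by linear_combination 28686 * (n : ℝ) * hL

theorem exists_algorithmSuccess_ge (hn : 2 ≤ n) :
    ∃ steps : List (Step (Fin 2) (gridGraph n)),
      (steps.length : ℝ) ≤ 28686 * (n * Real.log ((n : ℝ) ^ 2)) ∧
      ∀ v : Grid n, 1 / 2 ≤ algorithmSuccess steps (originState n) fun w => decide (w = v) := by
  obtain ⟨T, hT, hs⟩ := exists_walkSuccess_ge hn
  have hL : 0 < Real.log ((n : ℝ) ^ 2) := one_pos.trans_le (one_le_log_sq (mod_cast hn))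
  have hp : 0 < walkSuccess n 0 T := lt_of_lt_of_le (by positivity) (hs 0)
  obtain ⟨k, hk, hbig⟩ := exists_algorithmSuccess_amplify_ge hp (walkSteps n T)
    (r := originReflection n) (sqNorm_originState (n := n)) fun _ => rfl
  refine ⟨_, length_amplify_walkSteps_le hn hT (hk.trans ?_) (originReflection n), fun v => ?_⟩
  · calc (√(walkSuccess n 0 T))⁻¹ ≤ (√((1 / 1024) ^ 2 / Real.log ((n : ℝ) ^ 2)))⁻¹ := by
          gcongr
          exact hs 0
      _ = 1024 * √(Real.log ((n : ℝ) ^ 2)) := by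
          rw [Real.sqrt_div (by positivity), Real.sqrt_sq (by norm_num), inv_div]
          ring
  · exact hbig _ ((algorithmSuccess_walkSteps v T).trans (walkSuccess_eq_zero_vertex v T))

end LocalWalk

end GridSearch

theorem theorem3 :
    -- the quantum walk search: `O(√(N log N))` steps, success probability `Ω(1 / log N)`
    (∃ C c : ℝ, 0 < C ∧ 0 < c ∧
      ∀ (n : ℕ) [NeZero n], 2 ≤ n → ∀ N : ℝ, N = (n : ℝ) ^ 2 →
        ∃ T : ℕ, (T : ℝ) ≤ C * √(N * Real.log N) ∧
          ∀ v : GridSearch.Grid n, c / Real.log N ≤ GridSearch.walkSuccess n v T) ∧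
    -- a local search algorithm with `O(√N log N)` steps and constant success probability
    (∃ C c : ℝ, 0 < C ∧ 0 < c ∧
      ∀ (n : ℕ) [NeZero n], 2 ≤ n → ∀ N : ℝ, N = (n : ℝ) ^ 2 →
        ∃ steps : List (GridSearch.Step (Fin 2) (GridSearch.gridGraph n)),
          (steps.length : ℝ) ≤ C * (√N * Real.log N) ∧
          ∀ v : GridSearch.Grid n,
            c ≤ GridSearch.algorithmSuccess steps (GridSearch.originState n)
              (fun w => decide (w = v))) := by
  refine ⟨⟨4, (1 / 1024) ^ 2, by norm_num, by norm_num, ?_⟩,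
    28686, 1 / 2, by norm_num, by norm_num, ?_⟩
  · rintro n _ hn N rfl
    exact GridSearch.exists_walkSuccess_ge hn
  · rintro n _ hn N rfl
    rw [Real.sqrt_sq (Nat.cast_nonneg n)]
    exact GridSearch.exists_algorithmSuccess_ge hn
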